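/- Set $\hbar=k_B=1$. Let $\tau>0$ and $0<T_c\le T_h$. Consider a cyclic heat engine of period $\tau$ with finite-dimensional state space $\mathbb{C}^n$, given by the following data, all $\tau$-periodic in $t$: a measurable modulation $\alpha_t\in[0,1]$ with $\min_t\alpha_t=0$ and $\max_t\alpha_t=1$; Hermitian Hamiltonians $H_t$, absolutely continuous in $t$; finitely many jump operators $L_k(t)$, measurable and square-integrable over a period; and density matrices $\varrho_t$, absolutely continuous in $t$, which for almost every $t$ satisfy the Lindblad equation $$\dot\varrho_t=-i[H_t,\varrho_t]+\sum_k\Big(L_k\varrho_tL_k^\dagger-\tfrac12\{L_k^\dagger L_k,\varrho_t\}\Big).$$ The bath has temperature $T_t=T_cT_h/[T_h+\alpha_t(T_c-T_h)]$, and $\beta_t=1/T_t$. Local detailed balance holds: the jumps are paired by an involution $k\mapsto k'$ with $L_k(t)=e^{\beta_t\omega_k(t)/2}L_{k'}(t)^\dagger$ and $\omega_{k'}(t)=-\omega_k(t)$, where $\omega_k(t)\in\mathbb{R}$ is the energy released by the $k$th jump, i.e. $[L_k(t),H_t]=\omega_k(t)L_k(t)$. Let $Q_t=\mathrm{tr}(H_t\dot\varrho_t)$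 and define $$P_w=-\frac1\tau\int_0^\tau\mathrm{tr}(\dot H_t\varrho_t)\,dt,\quad J_q=\frac1\tau\int_0^\tau\alpha_tQ_t\,dt,\quad \eta_C=1-\frac{T_c}{T_h},\quad \eta=\frac{P_w}{J_q},$$ $$\overline a_\tau=\frac1\tau\int_0^\tau\sum_k\mathrm{tr}\big(L_k(t)\varrho_tL_k(t)^\dagger\big)\,dt,\qquad \Sigma_\tau=\mathrm{tr}(\varrho_0\ln\varrho_0)-\mathrm{tr}(\varrho_\tau\ln\varrho_\tau)-\int_0^\tau\beta_tQ_t\,dt .$$ For density matrices $\varrho,\sigma$ with eigenvalues $a_1\le a_2\le\cdots$ and $b_1\le b_2\le\cdots$ (with multiplicity), let $W(\varrho,\sigma)=\frac12\sum_n|a_n-b_n|$ be the quantum Wasserstein distance. Then the length $$\ell_W=\lim_{K\to\infty}\sum_{k=0}^{K-1}W\big(\varrho_{k\tau/K},\varrho_{(k+1)\tau/K}\big)$$ exists and is finite; either $\ell_W<\tau\overline a_\tau$, or $\ell_W=\overline a_\tau=0$ (in which case the right-hand sides below are read as $0$); the entropy production satisfies $$\Sigma_\tau\ge 2\,\ell_W\,\mathrm{artanh}\Big(\frac{\ell_W}{\tau\overline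 a_\tau}\Big);$$ and if $P_w\ne0$ and $J_q\ne0$ (so that $\eta$ is defined and nonzero), then $$P_w\Big(\frac{\eta_C}{\eta}-1\Big)\ \ge\ 2T_c\,\frac{\ell_W}{\tau}\,\mathrm{artanh}\Big(\frac{\ell_W}{\tau\overline a_\tau}\Big).$$ -/

import Mathlib

open MeasureTheory Filter Topology
open scoped Matrix ComplexOrder

noncomputable section

/-- The entrywise time derivative of a matrix-valued function. -/
def matDeriv {n : Type*} (A : ℝ → Matrix n n ℂ) (t : ℝ) : Matrix n n ℂ :=
  Matrix.of fun i j => deriv (fun s => A s i j) t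

/-- The dissipator `D[L]ρ = L ρ L† - (L†L ρ + ρ L†L) / 2`. -/
def dissipator {n : Type*} [Fintype n] (L ρ : Matrix n n ℂ) : Matrix n n ℂ :=
  L * ρ * Lᴴ - (1 / 2 : ℂ) • (Lᴴ * L * ρ + ρ * (Lᴴ * L))

/-- The right-hand side `-i[H, ρ] + ∑ₖ D[Lₖ]ρ` of the Lindblad master equation (`ħ = 1`). -/
def lindbladGenerator {n κ : Type*} [Fintype n] [Fintype κ]
    (H : Matrix n n ℂ) (L : κ → Matrix n n ℂ) (ρ : Matrix n n ℂ) : Matrix n n ℂ :=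
  -(Complex.I • (H * ρ - ρ * H)) + ∑ k, dissipator (L k) ρ

/-- The quantum Wasserstein distance `W(A, B) = ∑ₙ |aₙ - bₙ| / 2` between Hermitian matrices,
where `aₙ` and `bₙ` are the eigenvalues (with multiplicity) in the same monotone order.
(`eigenvalues₀` lists them in decreasing order; using the increasing order for both matrices
permutes the summands.) -/
def quantumWasserstein {n : Type*} [Fintype n] [DecidableEq n] {A B : Matrix n n ℂ}
    (hA : A.IsHermitian) (hB : B.IsHermitian) : ℝ :=
  (∑ i, |hA.eigenvalues₀ i - hB.eigenvalues₀ i|) / 2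

/-- The von Neumann entropy `-tr (A ln A)`, with `0 ln 0 = 0`. -/
def vonNeumannEntropy {n : Type*} [Fintype n] [DecidableEq n] {A : Matrix n n ℂ}
    (hA : A.IsHermitian) : ℝ :=
  ∑ i, Real.negMulLog (hA.eigenvalues i)

/-- The temperature `T_t = T_c T_h / (T_h + α_t (T_c - T_h))` of the heat bath, as a function of
the value of the modulation `α_t`. -/
def bathTemperature (Tc Th a : ℝ) : ℝ :=
  Tc * Th / (Th + a * (Tc - Th))

/-- A cyclic heat engine with period `τ` whose finite-dimensional working medium obeys a Lindblad
master equation with local detailed balance (`ħ = k_B = 1`). The state space is `ℂⁿ`, and the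
jump operators are indexed by the finite type `κ`. -/
structure CyclicHeatEngine (n κ : Type*) [Fintype n] [Fintype κ] where
  /-- The period. -/
  τ : ℝ
  τ_pos : 0 < τ
  /-- The minimum temperature of the bath. -/
  Tc : ℝ
  /-- The maximum temperature of the bath. -/
  Th : ℝ
  Tc_pos : 0 < Tc
  Tc_le_Th : Tc ≤ Th
  /-- The temperature modulation; it need not be continuous (it may be a step function). -/
  α : ℝ → ℝ
  α_measurable : Measurable α
  α_periodic : Function.Periodic α τ
  α_mem : ∀ t, α t ∈ Set.Icc (0 : ℝ) 1
  α_eq_zero : ∃ t, α t = 0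
  α_eq_one : ∃ t, α t = 1
  /-- The Hamiltonian. -/
  H : ℝ → Matrix n n ℂ
  H_hermitian : ∀ t, (H t).IsHermitian
  H_periodic : Function.Periodic H τ
  H_absCont : ∀ i j, AbsolutelyContinuousOnInterval (fun t => H t i j) 0 τ
  /-- The jump operators. -/
  L : κ → ℝ → Matrix n n ℂ
  L_periodic : ∀ k, Function.Periodic (L k) τ
  L_memLp : ∀ k i j, MemLp (fun t => L k t i j) 2 (volume.restrict (Set.Ioc 0 τ))
  /-- The energy released into the bath by a jump. -/
  ω : κ → ℝ → ℝ
  /-- The jump `k'` paired with the jump `k`. -/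
  pair : κ → κ
  pair_pair : ∀ k, pair (pair k) = k
  ω_pair : ∀ k t, ω (pair k) t = -ω k t
  /-- The jump `k` maps energy eigenvectors of energy `e` to energy `e - ω k t`. -/
  energy_change : ∀ k t, L k t * H t - H t * L k t = (ω k t : ℂ) • L k t
  /-- Local detailed balance `L_k = exp (β_t ω_k / 2) (L_k')†`, with `β_t = 1 / T_t`. -/
  detailed_balance : ∀ k t,
    L k t = (Real.exp (1 / bathTemperature Tc Th (α t) * ω k t / 2) : ℂ) • (L (pair k) t)ᴴ
  /-- The density matrix. -/
  ρ : ℝ → Matrix n n ℂ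
  ρ_posSemidef : ∀ t, (ρ t).PosSemidef
  ρ_trace : ∀ t, (ρ t).trace = 1
  ρ_periodic : Function.Periodic ρ τ
  ρ_absCont : ∀ i j, AbsolutelyContinuousOnInterval (fun t => ρ t i j) 0 τ
  /-- The Lindblad master equation (at almost every time, as the protocol may jump). -/
  master_equation : ∀ᵐ t, ∀ i j,
    HasDerivAt (fun s => ρ s i j) (lindbladGenerator (H t) (fun k => L k t) (ρ t) i j) t

namespace CyclicHeatEngine

variable {n κ : Type*} [Fintype n] [Fintype κ] (E : CyclicHeatEngine n κ)

/-- The inverse temperature `β_t = 1 / T_t` of the bath. -/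
def β (t : ℝ) : ℝ := 1 / bathTemperature E.Tc E.Th (E.α t)

/-- The work power `P_w = -τ⁻¹ ∫₀^τ tr (Ḣ_t ρ_t) dt`. -/
def power : ℝ :=
  -(E.τ⁻¹ * ∫ t in (0 : ℝ)..E.τ, (matDeriv E.H t * E.ρ t).trace.re)

/-- The rate `Q_t = tr (H_t ρ̇_t)` of heat absorbed by the engine. -/
def heatRate (t : ℝ) : ℝ := (E.H t * matDeriv E.ρ t).trace.re

/-- The heat supplied to the engine, `J_q = τ⁻¹ ∫₀^τ α_t Q_t dt`. -/
def heatSupply : ℝ := E.τ⁻¹ * ∫ t in (0 : ℝ)..E.τ, E.α t * E.heatRate t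

/-- The Carnot efficiency `η_C = 1 - T_c / T_h`. -/
def carnotEfficiency : ℝ := 1 - E.Tc / E.Th

/-- The efficiency `η = P_w / J_q`. -/
def efficiency : ℝ := E.power / E.heatSupply

/-- The time-averaged dynamical activity `ā_τ = τ⁻¹ ∫₀^τ ∑ₖ tr (L_k ρ L_k†) dt`. -/
def activity : ℝ :=
  E.τ⁻¹ * ∫ t in (0 : ℝ)..E.τ, ∑ k, (E.L k t * E.ρ t * (E.L k t)ᴴ).trace.re

/-- The entropy production `Σ_τ = ΔS - ∫₀^τ β_t Q_t dt` in one period. -/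
def entropyProduction [DecidableEq n] : ℝ :=
  (vonNeumannEntropy (E.ρ_posSemidef E.τ).isHermitian
      - vonNeumannEntropy (E.ρ_posSemidef 0).isHermitian)
    - ∫ t in (0 : ℝ)..E.τ, E.β t * E.heatRate t

/-- `E.IsWassersteinLength ℓ`: the number `ℓ` is the length of the curve `(ρ_t)`, `0 ≤ t ≤ τ`,
in the quantum Wasserstein distance, that is, the limit of
`∑_{k < K} W(ρ_{k δt}, ρ_{(k+1) δt})`, `δt = τ / K`, as `K → ∞`. -/
def IsWassersteinLength [DecidableEq n] (ℓ : ℝ) : Prop :=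
  Tendsto (fun K : ℕ => ∑ k ∈ Finset.range K,
    quantumWasserstein (E.ρ_posSemidef ((k : ℝ) * (E.τ / K))).isHermitian
      (E.ρ_posSemidef (((k : ℝ) + 1) * (E.τ / K))).isHermitian) atTop (𝓝 ℓ)

end CyclicHeatEngine

end

/-!
The entropy production over a period is `Σ = -∫ β Q`, since the state returns to itself. In an
instantaneous eigenbasis of `ρ` the populations `p i` obey a classical master equation with jump
rates `w k m j = |⟨m|L_k|j⟩|²`, and local detailed balance relates opposite jumps by
`w k m j = exp (β ω_k) w k' j m`. After adding the derivative `-(d/dt) ∑ p log p` of the entropy,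
whose integral over a period vanishes, the entropy production rate is a sum over pairs of opposite fluxes
`a, b` of `(a - b) log (a / b) = 2 f (|a - b|, a + b)`, where `f (J, A) = J artanh (J / A)`. The
function `f` is convex and homogeneous of degree one, so it is the supremum of linear functions, its
tangent planes: with `J / A = tanh z`,
`f (J, A) ≥ (z + sinh z cosh z) J - sinh² z A` (`flux_mul_affinity_ge`).

Linear bounds can be summed over jumps and integrated over time. Summed over pairs, the currents
`∑ |a - b|` dominate the Wasserstein speed `∑ |ṗ i| / 2`, and the traffic `∑ (a + b)` is the
activity. This gives
`Σ ≥ 2 (z + sinh z cosh z) ℓ - 2 sinh² z τ ā` for every `z ≥ 0`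
(`entropyProduction_ge_tangent`), and the choice `tanh z = ℓ / (τ ā)` is the bound on `Σ`.
If `ℓ ≥ τ ā` and `ℓ > 0`, letting `z → ∞` would make `Σ` infinite, which gives the alternative for `ℓ` (`two_mul_artanh_le_of_tangent`).

Three points need care.

* The ordered eigenvalues are absolutely continuous by Weyl's inequality
  (`Matrix.IsHermitian.abs_eigenvalues_sub_le`). Their derivatives are `⟨u_i, ρ̇ u_i⟩` in a suitable
  eigenbasis even at level crossings (`exists_unitary_diag_deriv_eq`). The length exists because the
  variation of a continuous function of bounded variation is the limit over uniform partitions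
  (`tendsto_sum_abs_sub_uniform_partition`).
* Populations may vanish, so `log p` is replaced by `log (p + ε)`. The error is of order
  `ε log (1 / ε) ∫ ∑ ‖L_k‖²`: the affinities `β ω_k` of nonzero jumps are bounded, because `ω_k` is
  then a difference of energy levels (`abs_energyChange_le`).
* The work is the integral of the heat rate over a period, and `β = 1 / T_c - (η_C / T_c) α`, so
  `T_c Σ / τ = η_C J_q - P_w` (`entropyProduction_eq_power_heatSupply`). This turns the bound on `Σ`
  into the bound on the power.
-/

/-! ### Convexity of `J artanh (J / A)` -/

/-- The tangent inequality behind the convexity of `J artanh (J / A)`. -/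
lemma sinh_mul_sinh_sub_le {u z : ℝ} (hu : 0 ≤ u) (hz : 0 ≤ z) :
    Real.sinh z * Real.sinh (u - z) ≤ (u - z) * Real.sinh u := by
  rcases le_total z u with h | h
  · have hd : 0 ≤ u - z := sub_nonneg.2 h
    have h1 : Real.sinh (u - z) ≤ (u - z) * Real.cosh (u - z) := by
      have hc : MonotoneOn (fun x => x * Real.cosh x - Real.sinh x) (Set.Ici 0) := by
        apply monotoneOn_of_deriv_nonneg (convex_Ici 0) (by fun_prop) (by fun_prop)
        intro x hx
        rw [interior_Ici, Set.mem_Ioi] at hx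
        have : HasDerivAt (fun x => x * Real.cosh x - Real.sinh x)
            (1 * Real.cosh x + x * Real.sinh x - Real.cosh x) x :=
          ((hasDerivAt_id x).mul (Real.hasDerivAt_cosh x)).sub (Real.hasDerivAt_sinh x)
        rw [this.deriv]
        have := mul_nonneg hx.le (Real.sinh_nonneg_iff.2 hx.le)
        linarith
      have := hc (Set.self_mem_Ici) hd hd
      simp at this
      linarith
    have h2 : Real.sinh u = Real.sinh z * Real.cosh (u - z) + Real.cosh z * Real.sinh (u - z) := by
      rw [← Real.sinh_add]; ring_nf
    rw [h2]
    have h3 := mul_le_mul_of_nonneg_left h1 (Real.sinh_nonneg_iff.2 hz)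
    have h4 := mul_nonneg hd (mul_nonneg (Real.cosh_pos z).le (Real.sinh_nonneg_iff.2 hd))
    nlinarith
  · have h1 : z - u ≤ Real.sinh (z - u) := Real.self_le_sinh_iff.2 (sub_nonneg.2 h)
    have h2 : Real.sinh u ≤ Real.sinh z := Real.sinh_le_sinh.2 h
    have h3 : Real.sinh (u - z) = - Real.sinh (z - u) := by rw [← Real.sinh_neg]; ring_nf
    have h4 := mul_le_mul h1 h2 (Real.sinh_nonneg_iff.2 hu)
      ((sub_nonneg.2 h).trans h1)
    rw [h3]; linarith

/-- For fluxes `a, b` with `a / b = exp y`, the function `(a - b) y / 2 = f (|a - b|, a + b)`,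
`f (J, A) = J artanh (J / A)`, lies above the tangent plane of `f` along the ray
`J / A = tanh z`. -/
lemma flux_mul_affinity_ge {a b y z : ℝ} (hb : 0 ≤ b) (hab : a = Real.exp y * b)
    (hz : 0 ≤ z) :
    (z + Real.sinh z * Real.cosh z) * |a - b| - Real.sinh z ^ 2 * (a + b)
      ≤ (a - b) * y / 2 := by
  wlog hy : 0 ≤ y generalizing a b y
  · have ha : 0 ≤ a := hab ▸ mul_nonneg (Real.exp_pos y).le hb
    have h := @this b a (-y) ha (by rw [hab, ← mul_assoc, ← Real.exp_add]; simp)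
      (by linarith)
    rw [abs_sub_comm, add_comm a b]
    linarith
  have hy2 : 0 ≤ y / 2 := by linarith
  -- `a - b` and `a + b` are the common factor `k` times `sinh (y / 2)` and `cosh (y / 2)`
  obtain ⟨k, hk⟩ : ∃ k, k = 2 * b * Real.exp (y / 2) := ⟨_, rfl⟩
  have hk0 : 0 ≤ k := hk ▸ by positivity
  have he : Real.exp y = Real.exp (y / 2) * Real.exp (y / 2) := by rw [← Real.exp_add]; ring_nf
  have hn : Real.exp (y / 2) * Real.exp (-(y / 2)) = 1 := by rw [← Real.exp_add]; simp
  have hs : a - b = k * Real.sinh (y / 2) := by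
    rw [hab, hk, Real.sinh_eq, he]; linear_combination b * hn
  have hc : a + b = k * Real.cosh (y / 2) := by
    rw [hab, hk, Real.cosh_eq, he]; linear_combination - b * hn
  rw [hs, hc, abs_of_nonneg (mul_nonneg hk0 (Real.sinh_nonneg_iff.2 hy2))]
  have h := mul_le_mul_of_nonneg_left (sinh_mul_sinh_sub_le hy2 hz) hk0
  rw [Real.sinh_sub] at h
  linarith

/-- A number bounded below by all tangent planes of `2 J artanh (J / A)` at `(ℓ, A)` is bounded
below by the function itself; finiteness of the bound forces `ℓ < A`, except at the origin. -/
lemma two_mul_artanh_le_of_tangent {S ℓ A : ℝ} (hℓ : 0 ≤ ℓ) (hA : 0 ≤ A)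
    (h : ∀ z, 0 ≤ z → 2 * (z + Real.sinh z * Real.cosh z) * ℓ - 2 * Real.sinh z ^ 2 * A ≤ S) :
    (ℓ < A ∨ (ℓ = 0 ∧ A = 0)) ∧ 2 * ℓ * Real.artanh (ℓ / A) ≤ S := by
  have key : ℓ < A ∨ (ℓ = 0 ∧ A = 0) := by
    rcases lt_or_ge ℓ A with hlt | hge
    · exact Or.inl hlt
    right
    rcases hℓ.eq_or_lt with h0 | hpos
    · exact ⟨h0.symm, by linarith⟩
    exfalso
    have hz := h ((|S| + 1) / (2 * ℓ)) (by positivity)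
    set z := (|S| + 1) / (2 * ℓ) with hzdef
    have hz0 : 0 ≤ z := by positivity
    have h1 : 2 * z * ℓ = |S| + 1 := by rw [hzdef]; field_simp
    have hs := Real.sinh_nonneg_iff.2 hz0
    have hsc : Real.sinh z ≤ Real.cosh z := (Real.sinh_lt_cosh z).le
    have h2 : Real.sinh z ^ 2 * A ≤ Real.sinh z * Real.cosh z * ℓ := by
      rw [sq]; gcongr
    have := le_abs_self S
    linarith
  refine ⟨key, ?_⟩
  rcases key with hlt | ⟨h0, h0'⟩
  · have hApos : 0 < A := hℓ.trans_lt hlt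
    have hr0 : 0 ≤ ℓ / A := by positivity
    have hr1 : ℓ / A < 1 := (div_lt_one hApos).2 hlt
    have hz := h (Real.artanh (ℓ / A)) (Real.artanh_nonneg hr0)
    have ht := Real.tanh_artanh (x := ℓ / A) ⟨by linarith, hr1⟩
    set z := Real.artanh (ℓ / A)
    have : Real.sinh z * A = Real.cosh z * ℓ := by
      rw [Real.tanh_eq_sinh_div_cosh, div_eq_div_iff (Real.cosh_pos z).ne' hApos.ne'] at ht
      linarith
    linear_combination hz + 2 * Real.sinh z * this
  · have := h 0 le_rfl
    simp only [h0, h0'] at this ⊢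
    simpa using this

/-! ### Entropy production of a jump process -/

/-- One pair of opposite jumps, with rates `w`, `w'` and populations `p`, `p'`. Shifting the
populations by `ε` inside the logarithms keeps them finite. -/
lemma flux_mul_regularized_affinity_ge {w w' p p' x z ε Y : ℝ} (hw : 0 ≤ w) (hw' : 0 ≤ w')
    (hww : w = Real.exp x * w') (hp : 0 ≤ p) (hp' : 0 ≤ p') (hε : 0 < ε) (hz : 0 ≤ z)
    (hY : w ≠ 0 → |x + Real.log (p + ε) - Real.log (p' + ε)| ≤ Y) :
    (z + Real.sinh z * Real.cosh z) * |w * p - w' * p'| - Real.sinh z ^ 2 * (w * p + w' * p')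
      - ε * (z + Real.sinh z * Real.cosh z + Real.sinh z ^ 2 + Y / 2) * (w + w')
      ≤ (w * p - w' * p') * (x + Real.log (p + ε) - Real.log (p' + ε)) / 2 := by
  rcases eq_or_ne w 0 with h0 | h0
  · have : w' = 0 := by
      rw [h0] at hww
      exact (mul_eq_zero.1 hww.symm).resolve_left (Real.exp_pos x).ne'
    simp [h0, this]
  have hY := hY h0
  set y := x + Real.log (p + ε) - Real.log (p' + ε) with hy
  set c := z + Real.sinh z * Real.cosh z with hc
  set s := Real.sinh z ^ 2
  have hc0 : 0 ≤ c := by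
    have := Real.sinh_nonneg_iff.2 hz
    have := Real.cosh_pos z
    positivity
  have hfl : w * (p + ε) = Real.exp y * (w' * (p' + ε)) := by
    rw [hy, Real.exp_sub, Real.exp_add, Real.exp_log (by positivity),
      Real.exp_log (by positivity), hww]
    field_simp
  have h := flux_mul_affinity_ge (by positivity) hfl hz
  have hdiff : w * (p + ε) - w' * (p' + ε) = (w * p - w' * p') + ε * (w - w') := by ring
  have habs : |w - w'| ≤ w + w' := abs_le.2 ⟨by linarith, by linarith⟩
  have h1 : |w * p - w' * p'| ≤ |w * (p + ε) - w' * (p' + ε)| + ε * (w + w') := by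
    have : w * p - w' * p' = (w * (p + ε) - w' * (p' + ε)) - ε * (w - w') := by ring
    rw [this]
    refine (abs_sub _ _).trans ?_
    rw [abs_mul, abs_of_pos hε]
    gcongr
  have h2 : (w - w') * y ≤ (w + w') * Y :=
    (le_abs_self _).trans <| by rw [abs_mul]; gcongr
  have h1' := mul_le_mul_of_nonneg_left h1 hc0
  have h2' := mul_le_mul_of_nonneg_left h2 hε.le
  rw [hdiff] at h h1'
  linarith

/-- The entropy production rate of a Markov jump process with rates `w k m j` (for the jump `j → m`
through the channel `k`) obeying local detailed balance, with regularized surprisals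
`-log (p i + ε)`, in terms of the probability currents and the activity. -/
lemma jump_entropyProduction_ge {n κ : Type*} [Fintype n] [Fintype κ]
    {w : κ → n → n → ℝ} {x : κ → ℝ} {pair : κ → κ} {p d : n → ℝ} {ε X z : ℝ}
    (hw : ∀ k m j, 0 ≤ w k m j) (hpair : ∀ k, pair (pair k) = k)
    (hx : ∀ k, x (pair k) = -x k)
    (hdb : ∀ k m j, w k m j = Real.exp (x k) * w (pair k) j m)
    (hp : ∀ i, 0 ≤ p i) (hp1 : ∀ i, p i ≤ 1)
    (hd : ∀ i, d i = ∑ k, ∑ m, (w k i m * p m - w k m i * p i))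
    (hε : 0 < ε) (hε1 : ε ≤ 1) (hX : ∀ k m j, w k m j ≠ 0 → |x k| ≤ X) (hz : 0 ≤ z) :
    (z + Real.sinh z * Real.cosh z) * ∑ i, |d i|
      - 2 * Real.sinh z ^ 2 * ∑ k, ∑ m, ∑ j, w k m j * p j
      - ε * (2 * (z + Real.sinh z * Real.cosh z + Real.sinh z ^ 2) + (X + Real.log (2 / ε)))
        * ∑ k, ∑ m, ∑ j, w k m j
      ≤ ∑ k, x k * ∑ m, ∑ j, w k m j * p j - ∑ i, d i * Real.log (p i + ε) := by
  set c := z + Real.sinh z * Real.cosh z with hc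
  set s := Real.sinh z ^ 2
  set Y := X + Real.log (2 / ε) with hYdef
  have hc0 : 0 ≤ c := by
    have := Real.sinh_nonneg_iff.2 hz
    have := Real.cosh_pos z
    positivity
  have hlog : ∀ i j, Real.log (p i + ε) - Real.log (p j + ε) ≤ Real.log (2 / ε) := by
    intro i j
    rw [Real.log_div (by norm_num) hε.ne']
    have h1 : Real.log (p i + ε) ≤ Real.log 2 :=
      Real.log_le_log (by linarith [hp i]) (by linarith [hp1 i])
    have h2 : Real.log ε ≤ Real.log (p j + ε) := Real.log_le_log hε (by linarith [hp j])
    linarith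
  -- reversal of a jump
  have hinv : Function.Involutive
      (fun t : κ × n × n => ((pair t.1, t.2.2, t.2.1) : κ × n × n)) := fun t => by
    simp [hpair]
  have hrev : ∀ F : κ → n → n → ℝ,
      ∑ k, ∑ m, ∑ j, F (pair k) j m = ∑ k, ∑ m, ∑ j, F k m j := by
    intro F
    have := Equiv.sum_comp hinv.toPerm (fun t : κ × n × n => F t.1 t.2.1 t.2.2)
    simpa [Fintype.sum_prod_type] using this
  have hterm : ∀ k m j,
      c * |w k m j * p j - w (pair k) j m * p m| - s * (w k m j * p j + w (pair k) j m * p m)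
        - ε * (c + s + Y / 2) * (w k m j + w (pair k) j m)
      ≤ (w k m j * p j - w (pair k) j m * p m)
        * (x k + Real.log (p j + ε) - Real.log (p m + ε)) / 2 := by
    intro k m j
    refine flux_mul_regularized_affinity_ge (hw _ _ _) (hw _ _ _) (hdb _ _ _) (hp _) (hp _) hε hz
      fun h => ?_
    have h1 := abs_le.1 (hX k m j h)
    have h2 := hlog j m
    have h3 := hlog m j
    exact abs_le.2 ⟨by linarith, by linarith⟩
  have hsum := Finset.sum_le_sum fun k (_ : k ∈ Finset.univ) =>
    Finset.sum_le_sum fun m (_ : m ∈ Finset.univ) =>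
      Finset.sum_le_sum fun j (_ : j ∈ Finset.univ) => hterm k m j
  -- the currents bound the change of the populations
  have hcur : ∑ i, |d i| ≤ ∑ k, ∑ m, ∑ j, |w k m j * p j - w (pair k) j m * p m| := by
    rw [Finset.sum_comm]
    refine Finset.sum_le_sum fun i _ => ?_
    have hdi : d i = ∑ k, ∑ m, (w k i m * p m - w (pair k) m i * p i) := by
      rw [hd]
      simp only [Finset.sum_sub_distrib]
      congr 1
      exact (Equiv.sum_comp (Function.Involutive.toPerm pair hpair)
        (fun k => ∑ m, w k m i * p i)).symm
    rw [hdi]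
    exact (Finset.abs_sum_le_sum_abs _ _).trans
      (Finset.sum_le_sum fun k _ => Finset.abs_sum_le_sum_abs _ _)
  have hact := hrev fun k m j => w k m j * p j
  have hrate := hrev w
  -- symmetrization of the affinities under the reversal of jumps
  have haff : ∑ k, ∑ m, ∑ j, (w k m j * p j - w (pair k) j m * p m)
        * (x k + Real.log (p j + ε) - Real.log (p m + ε)) / 2
      = ∑ k, ∑ m, ∑ j, w k m j * p j
        * (x k + Real.log (p j + ε) - Real.log (p m + ε)) := by
    have h := hrev fun k m j => w k m j * p j * (x k + Real.log (p j + ε) - Real.log (p m + ε))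
    have h2 : ∀ a b : ℝ, b = a → (a + b) / 2 = a := by intros; linarith
    rw [← h2 _ _ h, ← Finset.sum_add_distrib, Finset.sum_div]
    refine Finset.sum_congr rfl fun k _ => ?_
    rw [← Finset.sum_add_distrib, Finset.sum_div]
    refine Finset.sum_congr rfl fun m _ => ?_
    rw [← Finset.sum_add_distrib, Finset.sum_div]
    refine Finset.sum_congr rfl fun j _ => ?_
    rw [hx]; ring
  have hheat : ∑ k, ∑ m, ∑ j, w k m j * p j
        * (x k + Real.log (p j + ε) - Real.log (p m + ε))
      = ∑ k, x k * ∑ m, ∑ j, w k m j * p j - ∑ i, d i * Real.log (p i + ε) := by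
    have h1 : ∑ i, d i * Real.log (p i + ε)
        = ∑ k, ∑ m, ∑ j, w k m j * p j * (Real.log (p m + ε) - Real.log (p j + ε)) := by
      simp only [hd, Finset.sum_mul, sub_mul, mul_sub, Finset.sum_sub_distrib]
      congr 1
      · exact Finset.sum_comm
      · rw [Finset.sum_comm]
        exact Finset.sum_congr rfl fun k _ => Finset.sum_comm
    rw [h1]
    simp only [Finset.mul_sum, ← Finset.sum_sub_distrib]
    refine Finset.sum_congr rfl fun k _ => Finset.sum_congr rfl fun m _ =>
      Finset.sum_congr rfl fun j _ => ?_
    ring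
  rw [← hheat, ← haff]
  refine le_trans (le_of_eq_of_le ?_ (sub_le_sub_right (sub_le_sub_right
    (mul_le_mul_of_nonneg_left hcur hc0) (2 * s * ∑ k, ∑ m, ∑ j, w k m j * p j))
    (ε * (2 * (c + s) + Y) * ∑ k, ∑ m, ∑ j, w k m j))) (le_of_eq_of_le ?_ hsum)
  · ring
  simp only [Finset.sum_sub_distrib, ← Finset.mul_sum, Finset.sum_add_distrib, hact, hrate]
  ring

/-! ### Eigenvalues of Hermitian matrices -/

lemma Matrix.star_dotProduct_self_eq_sum_norm_sq {n : Type*} [Fintype n] (x : n → ℂ) :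
    star x ⬝ᵥ x = ((∑ j, ‖x j‖ ^ 2 : ℝ) : ℂ) := by
  simp [dotProduct, Complex.conj_mul']

section Eigenvalues

variable {n : Type*} [Fintype n] [DecidableEq n]

lemma Matrix.IsHermitian.conjTranspose_mul_mul_eigenvectorUnitary {A : Matrix n n ℂ}
    (hA : A.IsHermitian) :
    (hA.eigenvectorUnitary : Matrix n n ℂ)ᴴ * A * (hA.eigenvectorUnitary : Matrix n n ℂ)
      = Matrix.diagonal fun i => (hA.eigenvalues i : ℂ) := by
  have := hA.conjStarAlgAut_star_eigenvectorUnitary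
  rw [Unitary.conjStarAlgAut_star_apply] at this
  exact this

lemma Matrix.sum_norm_sq_conjTranspose_mulVec {U : Matrix n n ℂ} (hU : U * Uᴴ = 1) (x : n → ℂ) :
    ∑ j, ‖(Uᴴ *ᵥ x) j‖ ^ 2 = ∑ j, ‖x j‖ ^ 2 := by
  have h := Matrix.star_dotProduct_self_eq_sum_norm_sq (Uᴴ *ᵥ x)
  rw [Matrix.star_mulVec, Matrix.conjTranspose_conjTranspose, ← Matrix.dotProduct_mulVec,
    Matrix.mulVec_mulVec, hU, Matrix.one_mulVec, Matrix.star_dotProduct_self_eq_sum_norm_sq] at h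
  exact_mod_cast h.symm

lemma Matrix.IsHermitian.re_star_dotProduct_mulVec {A : Matrix n n ℂ} (hA : A.IsHermitian)
    (x : n → ℂ) :
    (star x ⬝ᵥ (A *ᵥ x)).re =
      ∑ j, hA.eigenvalues j * ‖((hA.eigenvectorUnitary : Matrix n n ℂ)ᴴ *ᵥ x) j‖ ^ 2 := by
  set U := (hA.eigenvectorUnitary : Matrix n n ℂ) with hUdef
  have hU : U * Uᴴ = 1 := Unitary.coe_mul_star_self hA.eigenvectorUnitary
  have hd := hA.conjTranspose_mul_mul_eigenvectorUnitary
  rw [← hUdef] at hd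
  have hx : U *ᵥ (Uᴴ *ᵥ x) = x := by rw [Matrix.mulVec_mulVec, hU, Matrix.one_mulVec]
  have : star x ⬝ᵥ (A *ᵥ x) = star (Uᴴ *ᵥ x) ⬝ᵥ ((Uᴴ * A * U) *ᵥ (Uᴴ *ᵥ x)) := by
    rw [← Matrix.mulVec_mulVec, hx, ← Matrix.mulVec_mulVec, Matrix.star_mulVec,
      Matrix.conjTranspose_conjTranspose, ← Matrix.dotProduct_mulVec, Matrix.mulVec_mulVec, hU,
      Matrix.one_mulVec]
  rw [this, hd]
  have : star (Uᴴ *ᵥ x) ⬝ᵥ ((Matrix.diagonal fun i => (hA.eigenvalues i : ℂ)) *ᵥ (Uᴴ *ᵥ x))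
      = ((∑ j, hA.eigenvalues j * ‖(Uᴴ *ᵥ x) j‖ ^ 2 : ℝ) : ℂ) := by
    simp only [dotProduct, Matrix.mulVec_diagonal, Pi.star_apply, RCLike.star_def]
    push_cast
    refine Finset.sum_congr rfl fun j _ => ?_
    rw [← Complex.conj_mul']; ring
  rw [this, Complex.ofReal_re]

/-- Weyl's perturbation inequality (one-sided, with the entrywise `ℓ¹` norm): a dimension count
gives a nonzero vector in the intersection of the span of the eigenvectors of `A` up to the `i`th
with the span of those of `B` from the `i`th on, and the quadratic forms of `A` and `B` are compared
on it. -/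
lemma Matrix.IsHermitian.eigenvalues_sub_le {A B : Matrix n n ℂ} (hA : A.IsHermitian)
    (hB : B.IsHermitian) (i : n) :
    hA.eigenvalues i - hB.eigenvalues i ≤ ∑ j, ∑ k, ‖A j k - B j k‖ := by
  classical
  set e : n ≃ Fin (Fintype.card n) := (Fintype.equivOfCardEq (Fintype.card_fin _)).symm with he
  set U := (hA.eigenvectorUnitary : Matrix n n ℂ) with hUdef
  set V := (hB.eigenvectorUnitary : Matrix n n ℂ) with hVdef
  have hU : U * Uᴴ = 1 := Unitary.coe_mul_star_self hA.eigenvectorUnitary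
  have hV : V * Vᴴ = 1 := Unitary.coe_mul_star_self hB.eigenvectorUnitary
  -- the coordinates to be annihilated
  let f : (n → ℂ) →ₗ[ℂ] ({j // j ≠ i} → ℂ) :=
    LinearMap.pi fun j => if e j < e i then (LinearMap.proj j.1).comp Vᴴ.mulVecLin
      else (LinearMap.proj j.1).comp Uᴴ.mulVecLin
  have hker : LinearMap.ker f ≠ ⊥ := by
    apply LinearMap.ker_ne_bot_of_finrank_lt
    rw [Module.finrank_fintype_fun_eq_card, Module.finrank_fintype_fun_eq_card]
    exact Fintype.card_subtype_lt (x := i) (by simp)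
  obtain ⟨x, hx, hx0⟩ := (Submodule.ne_bot_iff _).1 hker
  have hf : ∀ j : {j // j ≠ i}, f x j = 0 := fun j => by
    rw [LinearMap.mem_ker] at hx; rw [hx]; rfl
  have hVx : ∀ j, e j < e i → (Vᴴ *ᵥ x) j = 0 := by
    intro j hj
    have := hf ⟨j, fun h => by simp [h] at hj⟩
    simpa [f, hj] using this
  have hUx : ∀ j, e i < e j → (Uᴴ *ᵥ x) j = 0 := by
    intro j hj
    have := hf ⟨j, fun h => by simp [h] at hj⟩
    simpa [f, hj.not_gt] using this
  have hN : 0 < ∑ j, ‖x j‖ ^ 2 := by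
    obtain ⟨j, hj⟩ := Function.ne_iff.1 hx0
    exact Finset.sum_pos' (fun _ _ => by positivity) ⟨j, Finset.mem_univ _, by
      have : 0 < ‖x j‖ := norm_pos_iff.2 hj
      positivity⟩
  have h1 : hA.eigenvalues i * ∑ j, ‖x j‖ ^ 2 ≤ (star x ⬝ᵥ (A *ᵥ x)).re := by
    rw [hA.re_star_dotProduct_mulVec, ← Matrix.sum_norm_sq_conjTranspose_mulVec hU,
      Finset.mul_sum]
    refine Finset.sum_le_sum fun j _ => ?_
    rcases lt_or_ge (e i) (e j) with h | h
    · simp [hUx j h, ← hUdef]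
    · exact mul_le_mul_of_nonneg_right (hA.eigenvalues₀_antitone h) (by positivity)
  have h2 : (star x ⬝ᵥ (B *ᵥ x)).re ≤ hB.eigenvalues i * ∑ j, ‖x j‖ ^ 2 := by
    rw [hB.re_star_dotProduct_mulVec, ← Matrix.sum_norm_sq_conjTranspose_mulVec hV,
      Finset.mul_sum]
    refine Finset.sum_le_sum fun j _ => ?_
    rcases lt_or_ge (e j) (e i) with h | h
    · simp [hVx j h, ← hVdef]
    · exact mul_le_mul_of_nonneg_right (hB.eigenvalues₀_antitone h) (by positivity)
  have h3 : (star x ⬝ᵥ (A *ᵥ x)).re - (star x ⬝ᵥ (B *ᵥ x)).re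
      ≤ (∑ j, ∑ k, ‖A j k - B j k‖) * ∑ j, ‖x j‖ ^ 2 := by
    rw [← Complex.sub_re, ← dotProduct_sub, ← Matrix.sub_mulVec]
    refine (Complex.re_le_norm _).trans ?_
    have hxj : ∀ j, ‖x j‖ ^ 2 ≤ ∑ j, ‖x j‖ ^ 2 := fun j =>
      Finset.single_le_sum (f := fun j => ‖x j‖ ^ 2) (fun _ _ => by positivity)
        (Finset.mem_univ j)
    generalize ∑ j, ‖x j‖ ^ 2 = N at hxj
    simp only [dotProduct, Matrix.mulVec, Finset.mul_sum, Finset.sum_mul]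
    refine norm_sum_le_of_le _ fun j _ => norm_sum_le_of_le _ fun k _ => ?_
    rw [norm_mul, norm_mul, Pi.star_apply, norm_star, Matrix.sub_apply, mul_left_comm]
    refine mul_le_mul_of_nonneg_left ?_ (norm_nonneg _)
    have := two_mul_le_add_sq ‖x j‖ ‖x k‖
    linarith [hxj j, hxj k]
  refine le_of_mul_le_mul_right ?_ hN
  linarith

/-- Weyl's perturbation inequality, with the entrywise `ℓ¹` norm. -/
lemma Matrix.IsHermitian.abs_eigenvalues_sub_le {A B : Matrix n n ℂ} (hA : A.IsHermitian)
    (hB : B.IsHermitian) (i : n) :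
    |hA.eigenvalues i - hB.eigenvalues i| ≤ ∑ j, ∑ k, ‖A j k - B j k‖ := by
  refine abs_le.2 ⟨?_, hA.eigenvalues_sub_le hB i⟩
  have := hB.eigenvalues_sub_le hA i
  simp only [norm_sub_rev (B _ _)] at this
  linarith

/-- First-order perturbation theory without an assumption of simple spectrum: where a curve of
Hermitian matrices and its ordered eigenvalues are differentiable, there is an eigenbasis adapted to
the perturbation, in which the derivatives of the eigenvalues are the diagonal entries of the
derivative of the matrix. The basis is a limit of eigenbases at nearby times. -/
lemma exists_unitary_diag_deriv_eq {A : ℝ → Matrix n n ℂ} (hA : ∀ s, (A s).IsHermitian)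
    {D : Matrix n n ℂ} {t : ℝ} (hD : ∀ i j, HasDerivAt (fun s => A s i j) (D i j) t)
    {p' : n → ℝ} (hp : ∀ i, HasDerivAt (fun s => (hA s).eigenvalues i) (p' i) t) :
    ∃ U : Matrix n n ℂ, Uᴴ * U = 1 ∧
      Uᴴ * A t * U = Matrix.diagonal (fun i => ((hA t).eigenvalues i : ℂ)) ∧
      ∀ i, (Uᴴ * D * U) i i = p' i := by
  -- times approaching `t`, with convergent eigenbases
  let s : ℕ → ℝ := fun k => t + 1 / ((k : ℝ) + 1)
  let W : ℕ → n → n → ℂ := fun k => ((hA (s k)).eigenvectorUnitary : Matrix n n ℂ)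
  have hK : IsCompact (Set.univ.pi fun _ : n => Set.univ.pi fun _ : n =>
      Metric.closedBall (0 : ℂ) 1) :=
    isCompact_univ_pi fun _ => isCompact_univ_pi fun _ => isCompact_closedBall _ _
  obtain ⟨U, -, φ, hφ, hlim⟩ := hK.tendsto_subseq (x := W) fun k i _ j _ => by
    rw [mem_closedBall_zero_iff]
    exact entry_norm_bound_of_unitary (hA (s k)).eigenvectorUnitary.2 i j
  have hs : Tendsto (s ∘ φ) atTop (𝓝[≠] t) := by
    refine tendsto_nhdsWithin_iff.2 ⟨?_, ?_⟩
    · have := (tendsto_one_div_add_atTop_nhds_zero_nat (𝕜 := ℝ)).const_add t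
      rw [add_zero] at this
      exact this.comp hφ.tendsto_atTop
    · refine Eventually.of_forall fun k => ?_
      have : (0 : ℝ) < 1 / ((φ k : ℝ) + 1) := by positivity
      simp [s]
      positivity
  have hW : ∀ i j, Tendsto (fun k => W (φ k) i j) atTop (𝓝 (U i j)) := fun i j =>
    tendsto_pi_nhds.1 (tendsto_pi_nhds.1 hlim i) j
  have hent : ∀ i j, Tendsto (fun k => A (s (φ k)) i j) atTop (𝓝 (A t i j)) := fun i j =>
    (hD i j).continuousAt.tendsto.comp (hs.mono_right nhdsWithin_le_nhds)
  have hev : ∀ i, Tendsto (fun k => (hA (s (φ k))).eigenvalues i) atTop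
      (𝓝 ((hA t).eigenvalues i)) := fun i =>
    (hp i).continuousAt.tendsto.comp (hs.mono_right nhdsWithin_le_nhds)
  let U' : Matrix n n ℂ := Matrix.of U
  let W' : ℕ → Matrix n n ℂ := fun k => ((hA (s k)).eigenvectorUnitary : Matrix n n ℂ)
  have hWW : ∀ k, (W' k)ᴴ * W' k = 1 := fun k =>
    Unitary.coe_star_mul_self (hA (s k)).eigenvectorUnitary
  have hWW' : ∀ k, W' k * (W' k)ᴴ = 1 := fun k =>
    Unitary.coe_mul_star_self (hA (s k)).eigenvectorUnitary
  have hAW : ∀ k, A (s k) * W' k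
      = W' k * Matrix.diagonal (fun i => ((hA (s k)).eigenvalues i : ℂ)) := fun k => by
    rw [← (hA (s k)).conjTranspose_mul_mul_eigenvectorUnitary, Matrix.mul_assoc, ← Matrix.mul_assoc,
      hWW', Matrix.one_mul]
  have hU1 : U'ᴴ * U' = 1 := by
    ext i j
    have h1 : Tendsto (fun k => ((W' (φ k))ᴴ * W' (φ k)) i j) atTop (𝓝 ((U'ᴴ * U') i j)) := by
      simp only [Matrix.mul_apply, Matrix.conjTranspose_apply]
      exact tendsto_finsetSum _ fun l _ => ((hW l i).star).mul (hW l j)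
    simp only [hWW] at h1
    exact tendsto_nhds_unique h1 tendsto_const_nhds |>.symm ▸ rfl
  have hAU : A t * U' = U' * Matrix.diagonal (fun i => ((hA t).eigenvalues i : ℂ)) := by
    ext i j
    have h1 : Tendsto (fun k => (A (s (φ k)) * W' (φ k)) i j) atTop (𝓝 ((A t * U') i j)) := by
      simp only [Matrix.mul_apply]
      exact tendsto_finsetSum _ fun l _ => (hent i l).mul (hW l j)
    simp only [hAW, Matrix.mul_diagonal] at h1
    rw [Matrix.mul_diagonal]
    exact tendsto_nhds_unique h1
      ((hW i j).mul ((Complex.continuous_ofReal.tendsto _).comp (hev j)))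
  have hdiag : U'ᴴ * A t * U' = Matrix.diagonal (fun i => ((hA t).eigenvalues i : ℂ)) := by
    rw [Matrix.mul_assoc, hAU, ← Matrix.mul_assoc, hU1, Matrix.one_mul]
  refine ⟨U', hU1, hdiag, fun i => ?_⟩
  have hUA : U'ᴴ * A t = Matrix.diagonal (fun i => ((hA t).eigenvalues i : ℂ)) * U'ᴴ := by
    have := congrArg Matrix.conjTranspose hAU
    rw [Matrix.conjTranspose_mul, Matrix.conjTranspose_mul, (hA t).eq,
      Matrix.diagonal_conjTranspose] at this
    rw [this]
    congr 2
    ext i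
    simp
  -- the difference quotient of `A`, between the eigenvectors at `t` and at nearby times
  have hquot : ∀ k, (U'ᴴ * (A (s k) - A t) * W' k) i i
      = (((hA (s k)).eigenvalues i - (hA t).eigenvalues i : ℝ) : ℂ) * (U'ᴴ * W' k) i i := by
    intro k
    rw [Matrix.mul_sub, Matrix.sub_mul, Matrix.mul_assoc, hAW, ← Matrix.mul_assoc, hUA,
      Matrix.mul_assoc _ U'ᴴ, Matrix.sub_apply, Matrix.mul_diagonal, Matrix.diagonal_mul]
    push_cast
    ring
  have hsl : ∀ i j,
      Tendsto (fun k => ((s (φ k) - t)⁻¹ : ℝ) • (A (s (φ k)) i j - A t i j)) atTop (𝓝 (D i j)) :=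
    fun i j => (hasDerivAt_iff_tendsto_slope.1 (hD i j)).comp hs
  have hslp : Tendsto (fun k => ((s (φ k) - t)⁻¹ : ℝ) •
      ((hA (s (φ k))).eigenvalues i - (hA t).eigenvalues i)) atTop (𝓝 (p' i)) :=
    (hasDerivAt_iff_tendsto_slope.1 (hp i)).comp hs
  have hlhs : Tendsto (fun k => ((s (φ k) - t)⁻¹ : ℝ) •
      (U'ᴴ * (A (s (φ k)) - A t) * W' (φ k)) i i) atTop (𝓝 ((U'ᴴ * D * U') i i)) := by
    simp only [Matrix.mul_apply, Finset.smul_sum, Finset.sum_mul]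
    refine tendsto_finsetSum _ fun l _ => tendsto_finsetSum _ fun m _ => ?_
    have := ((hsl m l).const_mul (U'ᴴ i m)).mul (hW l i)
    refine this.congr fun k => ?_
    simp only [Matrix.sub_apply, Complex.real_smul]
    ring_nf
    rfl
  have hrhs : Tendsto (fun k => ((((s (φ k) - t)⁻¹ : ℝ) •
      ((hA (s (φ k))).eigenvalues i - (hA t).eigenvalues i) : ℝ) : ℂ)
        * (U'ᴴ * W' (φ k)) i i) atTop (𝓝 (p' i * (U'ᴴ * U') i i)) := by
    refine ((Complex.continuous_ofReal.tendsto _).comp hslp).mul ?_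
    simp only [Matrix.mul_apply]
    exact tendsto_finsetSum _ fun l _ => (hW l i).const_mul _
  rw [hU1, Matrix.one_apply_eq, mul_one] at hrhs
  refine tendsto_nhds_unique hlhs (hrhs.congr fun k => ?_)
  rw [hquot, smul_eq_mul, Complex.ofReal_mul, Complex.real_smul, mul_assoc]

end Eigenvalues

/-! ### Pointwise thermodynamics of the Lindblad generator -/

lemma trace_mul_commutator_self {n : Type*} [Fintype n] (H ρ : Matrix n n ℂ) :
    (H * (H * ρ - ρ * H)).trace = 0 := by
  rw [Matrix.mul_sub, Matrix.trace_sub, ← Matrix.mul_assoc H ρ H, Matrix.trace_mul_comm (H * ρ) H,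
    sub_self]

/-- A jump operator with a definite energy change `ω` dissipates the energy at the rate `ω` times
its activity. -/
lemma trace_mul_dissipator {n : Type*} [Fintype n] {H L : Matrix n n ℂ} {ω : ℝ}
    (hH : H.IsHermitian) (hL : L * H - H * L = (ω : ℂ) • L) (ρ : Matrix n n ℂ) :
    (H * dissipator L ρ).trace = -(ω * (L * ρ * Lᴴ).trace) := by
  have h1 : H * L = L * H - (ω : ℂ) • L := by rw [← hL]; abel
  have h2 : H * Lᴴ = Lᴴ * H + (ω : ℂ) • Lᴴ := by
    have := congrArg Matrix.conjTranspose hL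
    simp only [Matrix.conjTranspose_sub, Matrix.conjTranspose_mul, Matrix.conjTranspose_smul,
      hH.eq] at this
    rw [show star (ω : ℂ) = ω from Complex.conj_ofReal ω] at this
    rw [← this]; abel
  have h3 : H * (Lᴴ * L) = Lᴴ * L * H := by
    rw [← Matrix.mul_assoc, h2, Matrix.add_mul, Matrix.mul_assoc, h1, Matrix.mul_sub,
      Matrix.smul_mul, Matrix.mul_smul, Matrix.mul_assoc]
    abel
  have h4 : (H * (Lᴴ * L * ρ)).trace = (L * H * ρ * Lᴴ).trace := by
    rw [← Matrix.mul_assoc, h3, Matrix.trace_mul_comm (L * H * ρ)]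
    simp only [Matrix.mul_assoc]
  have h5 : (H * (ρ * (Lᴴ * L))).trace = (L * H * ρ * Lᴴ).trace := by
    rw [Matrix.trace_mul_comm (L * H * ρ), ← Matrix.mul_assoc, Matrix.trace_mul_comm (H * ρ)]
    simp only [Matrix.mul_assoc]
  have h6 : (H * (L * ρ * Lᴴ)).trace = (L * H * ρ * Lᴴ).trace - ω * (L * ρ * Lᴴ).trace := by
    rw [← Matrix.mul_assoc, ← Matrix.mul_assoc, h1]
    simp only [Matrix.sub_mul, Matrix.smul_mul, Matrix.trace_sub, Matrix.trace_smul, smul_eq_mul]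
  rw [dissipator, Matrix.mul_sub, Matrix.trace_sub, Matrix.mul_smul, Matrix.trace_smul,
    Matrix.mul_add, Matrix.trace_add, h4, h5, h6, smul_eq_mul]
  ring

/-- The heat rate is minus the energy released by the jumps. -/
lemma trace_mul_lindbladGenerator {n κ : Type*} [Fintype n] [Fintype κ] {H : Matrix n n ℂ}
    {L : κ → Matrix n n ℂ} {ω : κ → ℝ} (hH : H.IsHermitian)
    (hL : ∀ k, L k * H - H * L k = (ω k : ℂ) • L k) (ρ : Matrix n n ℂ) :
    (H * lindbladGenerator H L ρ).trace = -∑ k, (ω k : ℂ) * (L k * ρ * (L k)ᴴ).trace := by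
  rw [lindbladGenerator, Matrix.mul_add, Matrix.trace_add, Matrix.mul_neg, Matrix.mul_smul,
    Matrix.trace_neg, Matrix.trace_smul, trace_mul_commutator_self, Matrix.mul_sum,
    Matrix.trace_sum]
  simp [trace_mul_dissipator hH (hL _)]

/-- The Lindblad generator is covariant under changes of orthonormal basis. -/
lemma conj_lindbladGenerator {n κ : Type*} [Fintype n] [DecidableEq n] [Fintype κ]
    {U : Matrix n n ℂ} (hU : U * Uᴴ = 1) (H : Matrix n n ℂ) (L : κ → Matrix n n ℂ)
    (ρ : Matrix n n ℂ) :
    Uᴴ * lindbladGenerator H L ρ * U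
      = lindbladGenerator (Uᴴ * H * U) (fun k => Uᴴ * L k * U) (Uᴴ * ρ * U) := by
  have hmul : ∀ X Y : Matrix n n ℂ, Uᴴ * (X * Y) * U = (Uᴴ * X * U) * (Uᴴ * Y * U) := by
    intro X Y
    calc Uᴴ * (X * Y) * U = Uᴴ * X * 1 * Y * U := by simp only [Matrix.mul_one, Matrix.mul_assoc]
      _ = _ := by rw [← hU]; simp only [Matrix.mul_assoc]
  have hstar : ∀ X : Matrix n n ℂ, Uᴴ * Xᴴ * U = (Uᴴ * X * U)ᴴ := by
    intro X
    simp only [Matrix.conjTranspose_mul, Matrix.conjTranspose_conjTranspose, Matrix.mul_assoc]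
  simp only [lindbladGenerator, dissipator, Matrix.mul_add, Matrix.add_mul, Matrix.mul_neg,
    Matrix.neg_mul, Matrix.mul_sub, Matrix.sub_mul, Matrix.mul_smul, Matrix.smul_mul,
    Matrix.mul_sum, Matrix.sum_mul, hmul, hstar]

/-- The diagonal of the generator at a diagonal state is the Pauli master equation. -/
lemma lindbladGenerator_diagonal_apply_self {n κ : Type*} [Fintype n] [DecidableEq n] [Fintype κ]
    (H : Matrix n n ℂ) (L : κ → Matrix n n ℂ) (p : n → ℝ) (i : n) :
    lindbladGenerator H L (Matrix.diagonal fun j => (p j : ℂ)) i i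
      = ((∑ k, ∑ m, (‖L k i m‖ ^ 2 * p m - ‖L k m i‖ ^ 2 * p i) : ℝ) : ℂ) := by
  simp only [lindbladGenerator, dissipator, Matrix.add_apply, Matrix.neg_apply, Matrix.smul_apply,
    Matrix.sub_apply, Matrix.mul_diagonal, Matrix.diagonal_mul, Matrix.sum_apply]
  push_cast
  simp only [mul_comm (p i : ℂ), sub_self, smul_zero, neg_zero, zero_add]
  refine Finset.sum_congr rfl fun k _ => ?_
  rw [Finset.sum_sub_distrib, ← Finset.sum_mul]
  congr 1
  · rw [Matrix.mul_apply]
    refine Finset.sum_congr rfl fun m _ => ?_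
    rw [Matrix.mul_diagonal, Matrix.conjTranspose_apply, ← Complex.mul_conj']
    simp only [RCLike.star_def]
    ring
  · rw [Matrix.mul_apply, smul_eq_mul]
    simp only [Matrix.conjTranspose_apply, RCLike.star_def, Complex.conj_mul']
    ring

lemma trace_mul_diagonal_mul_conjTranspose {n : Type*} [Fintype n] [DecidableEq n]
    (L : Matrix n n ℂ) (p : n → ℝ) :
    (L * (Matrix.diagonal fun j => (p j : ℂ)) * Lᴴ).trace
      = ((∑ m, ∑ j, ‖L m j‖ ^ 2 * p j : ℝ) : ℂ) := by
  push_cast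
  simp only [Matrix.trace, Matrix.diag_apply]
  refine Finset.sum_congr rfl fun m _ => ?_
  rw [Matrix.mul_apply]
  refine Finset.sum_congr rfl fun j _ => ?_
  rw [Matrix.mul_diagonal, Matrix.conjTranspose_apply, ← Complex.mul_conj']
  simp only [RCLike.star_def]
  ring

/-- A nonzero jump operator changes the energy by a difference of energy levels; this bounds `ω` by
the entries of the Hamiltonian. -/
lemma abs_energyChange_le {n : Type*} [Fintype n] {H L : Matrix n n ℂ} {ω : ℝ}
    (hL : L * H - H * L = (ω : ℂ) • L) (hL0 : L ≠ 0) :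
    |ω| ≤ 2 * ∑ i, ∑ j, ‖H i j‖ := by
  obtain ⟨a, b, hab⟩ : ∃ a b, L a b ≠ 0 := by
    by_contra! h
    exact hL0 (Matrix.ext h)
  -- compare both sides at the entry of `L` of the largest modulus
  obtain ⟨⟨i, j⟩, -, hmax⟩ := Finset.exists_max_image (Finset.univ : Finset (n × n))
    (fun x => ‖L x.1 x.2‖) ⟨(a, b), Finset.mem_univ _⟩
  have hpos : 0 < ‖L i j‖ := (norm_pos_iff.2 hab).trans_le (hmax (a, b) (Finset.mem_univ _))
  have hrow : ∀ l, ∑ m, ‖H l m‖ ≤ ∑ i, ∑ j, ‖H i j‖ := fun l =>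
    Finset.single_le_sum (f := fun l => ∑ m, ‖H l m‖)
      (fun _ _ => Finset.sum_nonneg fun _ _ => norm_nonneg _) (Finset.mem_univ l)
  have hcol : ∀ m, ∑ l, ‖H l m‖ ≤ ∑ i, ∑ j, ‖H i j‖ := fun m => by
    rw [Finset.sum_comm]
    exact Finset.single_le_sum (f := fun m => ∑ l, ‖H l m‖)
      (fun _ _ => Finset.sum_nonneg fun _ _ => norm_nonneg _) (Finset.mem_univ m)
  have h1 : ‖(L * H) i j‖ ≤ ‖L i j‖ * ∑ i, ∑ j, ‖H i j‖ := by
    refine le_trans ?_ (mul_le_mul_of_nonneg_left (hcol j) hpos.le)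
    rw [Matrix.mul_apply, Finset.mul_sum]
    refine norm_sum_le_of_le _ fun l _ => ?_
    rw [norm_mul]
    exact mul_le_mul_of_nonneg_right (hmax (i, l) (Finset.mem_univ _)) (norm_nonneg _)
  have h2 : ‖(H * L) i j‖ ≤ ‖L i j‖ * ∑ i, ∑ j, ‖H i j‖ := by
    refine le_trans ?_ (mul_le_mul_of_nonneg_left (hrow i) hpos.le)
    rw [Matrix.mul_apply, Finset.mul_sum]
    refine norm_sum_le_of_le _ fun l _ => ?_
    rw [norm_mul, mul_comm]
    exact mul_le_mul_of_nonneg_right (hmax (l, j) (Finset.mem_univ _)) (norm_nonneg _)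
  have h3 : |ω| * ‖L i j‖ ≤ ‖(L * H) i j‖ + ‖(H * L) i j‖ := by
    have := congrArg (fun M : Matrix n n ℂ => ‖M i j‖) hL
    simp only [Matrix.sub_apply, Matrix.smul_apply, smul_eq_mul, norm_mul, Complex.norm_real,
      Real.norm_eq_abs] at this
    rw [← this]
    exact norm_sub_le _ _
  refine le_of_mul_le_mul_right ?_ hpos
  linarith

/-- The rate of entropy production of the Lindblad equation in an instantaneous eigenbasis `U` of
the state, with eigenvalues `p i` evolving at the rates `d i`, and with regularized surprisals
`-log (p i + ε)`. -/
lemma lindblad_entropyProduction_ge {n κ : Type*} [Fintype n] [DecidableEq n] [Fintype κ]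
    {H ρ U : Matrix n n ℂ} {L : κ → Matrix n n ℂ} {ω : κ → ℝ} {pair : κ → κ} {p d : n → ℝ}
    {b ε X z : ℝ} (hH : H.IsHermitian) (hpair : ∀ k, pair (pair k) = k)
    (hω : ∀ k, ω (pair k) = -ω k) (hL : ∀ k, L k * H - H * L k = (ω k : ℂ) • L k)
    (hdb : ∀ k, L k = (Real.exp (b * ω k / 2) : ℂ) • (L (pair k))ᴴ)
    (hU : Uᴴ * U = 1) (hρ : Uᴴ * ρ * U = Matrix.diagonal fun i => (p i : ℂ))
    (hd : ∀ i, (Uᴴ * lindbladGenerator H L ρ * U) i i = d i)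
    (hp : ∀ i, 0 ≤ p i) (hp1 : ∀ i, p i ≤ 1) (hε : 0 < ε) (hε1 : ε ≤ 1)
    (hX : |b| * (2 * ∑ i, ∑ j, ‖H i j‖) ≤ X) (hz : 0 ≤ z) :
    (z + Real.sinh z * Real.cosh z) * ∑ i, |d i|
      - 2 * Real.sinh z ^ 2 * ∑ k, (L k * ρ * (L k)ᴴ).trace.re
      - ε * (2 * (z + Real.sinh z * Real.cosh z + Real.sinh z ^ 2) + (X + Real.log (2 / ε)))
        * ∑ k, ∑ m, ∑ j, ‖L k m j‖ ^ 2
      ≤ -(b * (H * lindbladGenerator H L ρ).trace.re) - ∑ i, d i * Real.log (p i + ε) := by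
  have hU' : U * Uᴴ = 1 := mul_eq_one_comm.1 hU
  let M : κ → Matrix n n ℂ := fun k => Uᴴ * L k * U
  have hMdb : ∀ k, M k = (Real.exp (b * ω k / 2) : ℂ) • (M (pair k))ᴴ := by
    intro k
    simp only [M]
    conv_lhs => rw [hdb k]
    simp only [Matrix.conjTranspose_mul, Matrix.conjTranspose_conjTranspose, Matrix.mul_assoc,
      Matrix.smul_mul, Matrix.mul_smul]
  have hconj : ∀ k, ∀ R : Matrix n n ℂ,
      (M k * (Uᴴ * R * U) * (M k)ᴴ).trace = (L k * R * (L k)ᴴ).trace := by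
    intro k R
    have : M k * (Uᴴ * R * U) * (M k)ᴴ
        = Uᴴ * (L k * (U * Uᴴ) * R * (U * Uᴴ) * (L k)ᴴ * U) := by
      simp only [M, Matrix.conjTranspose_mul, Matrix.conjTranspose_conjTranspose, Matrix.mul_assoc]
    rw [this, Matrix.trace_mul_comm, hU', Matrix.mul_assoc, hU']
    simp only [Matrix.mul_one]
  have hact : ∀ k, (L k * ρ * (L k)ᴴ).trace.re = ∑ m, ∑ j, ‖M k m j‖ ^ 2 * p j := by
    intro k
    rw [← hconj, hρ, trace_mul_diagonal_mul_conjTranspose, Complex.ofReal_re]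
  have hnorm : ∀ k, ∑ m, ∑ j, ‖L k m j‖ ^ 2 = ∑ m, ∑ j, ‖M k m j‖ ^ 2 := by
    intro k
    have h1 := trace_mul_diagonal_mul_conjTranspose (L k) 1
    have h2 := trace_mul_diagonal_mul_conjTranspose (M k) 1
    have h3 := hconj k 1
    simp only [Pi.one_apply, Complex.ofReal_one, Matrix.diagonal_one, mul_one] at h1 h2
    rw [Matrix.mul_one, hU, Matrix.mul_one, Matrix.mul_one] at h3
    rw [h1, h2] at h3
    exact_mod_cast h3.symm
  have hdi : ∀ i, d i = ∑ k, ∑ m, (‖M k i m‖ ^ 2 * p m - ‖M k m i‖ ^ 2 * p i) := by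
    intro i
    have := hd i
    rw [conj_lindbladGenerator hU', hρ, lindbladGenerator_diagonal_apply_self] at this
    exact_mod_cast this.symm
  have hheat : -(b * (H * lindbladGenerator H L ρ).trace.re)
      = ∑ k, b * ω k * ∑ m, ∑ j, ‖M k m j‖ ^ 2 * p j := by
    rw [trace_mul_lindbladGenerator hH hL, Complex.neg_re, Complex.re_sum, mul_neg, neg_neg,
      Finset.mul_sum]
    simp only [Complex.re_ofReal_mul, hact]
    simp only [mul_assoc]
  rw [hheat]
  simp only [hact, hnorm]
  refine jump_entropyProduction_ge (w := fun k m j => ‖M k m j‖ ^ 2) (x := fun k => b * ω k)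
    (fun _ _ _ => by positivity) hpair (fun k => by rw [hω, mul_neg]) (fun k m j => ?_) hp hp1
    hdi hε hε1 (fun k m j h => ?_) hz
  · have : ‖M k m j‖ = Real.exp (b * ω k / 2) * ‖M (pair k) j m‖ := by
      conv_lhs => rw [hMdb k]
      rw [Matrix.smul_apply, Matrix.conjTranspose_apply, smul_eq_mul, norm_mul, norm_star,
        Complex.norm_real, Real.norm_of_nonneg (Real.exp_pos _).le]
    simp only [this]
    rw [mul_pow, sq (Real.exp _), ← Real.exp_add, add_halves]
  · have hL0 : L k ≠ 0 := by
      rintro h0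
      simp [M, h0] at h
    rw [abs_mul]
    exact (mul_le_mul_of_nonneg_left (abs_energyChange_le (hL k) hL0) (abs_nonneg b)).trans hX

/-! ### Absolutely continuous functions -/

lemma AbsolutelyContinuousOnInterval.of_dist_le_sum {ι X Y : Type*} [PseudoMetricSpace X]
    [PseudoMetricSpace Y] {s : Finset ι} {f : ℝ → X} {g : ι → ℝ → Y} {a b : ℝ}
    (hg : ∀ i ∈ s, AbsolutelyContinuousOnInterval (g i) a b)
    (h : ∀ x ∈ Set.uIcc a b, ∀ y ∈ Set.uIcc a b, dist (f x) (f y) ≤ ∑ i ∈ s, dist (g i x) (g i y)) :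
    AbsolutelyContinuousOnInterval f a b := by
  have hlim := tendsto_finsetSum s hg
  simp only [Finset.sum_const_zero] at hlim
  refine squeeze_zero' (Eventually.of_forall fun E => Finset.sum_nonneg fun _ _ => dist_nonneg) ?_
    hlim
  refine mem_inf_of_right fun E hE => ?_
  change ∑ i ∈ Finset.range E.1, dist (f (E.2 i).1) (f (E.2 i).2)
    ≤ ∑ i ∈ s, ∑ j ∈ Finset.range E.1, dist (g i (E.2 j).1) (g i (E.2 j).2)
  rw [Finset.sum_comm]
  exact Finset.sum_le_sum fun i hi => h _ (hE.1 i hi).1 _ (hE.1 i hi).2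

lemma AbsolutelyContinuousOnInterval.of_dist_le_mul {X Y : Type*} [PseudoMetricSpace X]
    [PseudoMetricSpace Y] {f : ℝ → X} {g : ℝ → Y} {a b C : ℝ}
    (hg : AbsolutelyContinuousOnInterval g a b)
    (h : ∀ x ∈ Set.uIcc a b, ∀ y ∈ Set.uIcc a b, dist (f x) (f y) ≤ C * dist (g x) (g y)) :
    AbsolutelyContinuousOnInterval f a b := by
  unfold AbsolutelyContinuousOnInterval at hg
  have hlim := hg.const_mul C
  rw [mul_zero] at hlim
  refine squeeze_zero' (Eventually.of_forall fun E => Finset.sum_nonneg fun _ _ => dist_nonneg) ?_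
    hlim
  refine mem_inf_of_right fun E hE => ?_
  change ∑ i ∈ Finset.range E.1, dist (f (E.2 i).1) (f (E.2 i).2)
    ≤ C * ∑ i ∈ Finset.range E.1, dist (g (E.2 i).1) (g (E.2 i).2)
  rw [Finset.mul_sum]
  exact Finset.sum_le_sum fun i hi => h _ (hE.1 i hi).1 _ (hE.1 i hi).2

lemma IntervalIntegrable.fun_finsetSum {ι E : Type*} [NormedAddCommGroup E] (s : Finset ι)
    {f : ι → ℝ → E} {a b : ℝ}
    (h : ∀ i ∈ s, IntervalIntegrable (f i) volume a b) :
    IntervalIntegrable (fun t => ∑ i ∈ s, f i t) volume a b :=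
  ⟨integrable_finsetSum s fun i hi => (h i hi).1, integrable_finsetSum s fun i hi => (h i hi).2⟩

lemma AbsolutelyContinuousOnInterval.complex_re {f : ℝ → ℂ} {a b : ℝ}
    (hf : AbsolutelyContinuousOnInterval f a b) :
    AbsolutelyContinuousOnInterval (fun t => (f t).re) a b :=
  hf.of_dist_le_mul (C := 1) fun x _ y _ => by
    rw [one_mul, Real.dist_eq, ← Complex.sub_re, dist_eq_norm]
    exact Complex.abs_re_le_norm _

lemma AbsolutelyContinuousOnInterval.complex_im {f : ℝ → ℂ} {a b : ℝ}
    (hf : AbsolutelyContinuousOnInterval f a b) :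
    AbsolutelyContinuousOnInterval (fun t => (f t).im) a b :=
  hf.of_dist_le_mul (C := 1) fun x _ y _ => by
    rw [one_mul, Real.dist_eq, ← Complex.sub_im, dist_eq_norm]
    exact Complex.abs_im_le_norm _

lemma AbsolutelyContinuousOnInterval.ae_hasDerivAt_complex {f : ℝ → ℂ} {a b : ℝ}
    (hf : AbsolutelyContinuousOnInterval f a b) :
    ∀ᵐ x, x ∈ Set.uIcc a b → HasDerivAt f
      (((deriv (fun t => (f t).re) x : ℝ) : ℂ)
        + ((deriv (fun t => (f t).im) x : ℝ) : ℂ) * Complex.I) x := by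
  filter_upwards [hf.complex_re.ae_differentiableAt, hf.complex_im.ae_differentiableAt]
    with x hx hx' hmem
  have := (hx hmem).hasDerivAt.ofReal_comp.add ((hx' hmem).hasDerivAt.ofReal_comp.mul_const
    Complex.I)
  refine this.congr_of_eventuallyEq (Eventually.of_forall fun t => ?_)
  simp

lemma AbsolutelyContinuousOnInterval.intervalIntegrable_deriv_complex {f : ℝ → ℂ} {a b : ℝ}
    (hf : AbsolutelyContinuousOnInterval f a b) :
    IntervalIntegrable (deriv f) volume a b := by
  have h : IntervalIntegrable (fun x => ((deriv (fun t => (f t).re) x : ℝ) : ℂ)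
      + ((deriv (fun t => (f t).im) x : ℝ) : ℂ) * Complex.I) volume a b := by
    have hr := hf.complex_re.intervalIntegrable_deriv
    have hi := hf.complex_im.intervalIntegrable_deriv
    exact ⟨hr.1.ofReal.add (hi.1.ofReal.mul_const _), hr.2.ofReal.add (hi.2.ofReal.mul_const _)⟩
  refine h.congr_ae ?_
  rw [EventuallyEq, ae_restrict_iff' measurableSet_uIoc]
  filter_upwards [hf.ae_hasDerivAt_complex] with x hx hmem
  exact (hx (Set.uIoc_subset_uIcc hmem)).deriv.symm

lemma AbsolutelyContinuousOnInterval.abs_sub_le_integral_abs_deriv {f : ℝ → ℝ} {a b : ℝ}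
    (hab : a ≤ b) (hf : AbsolutelyContinuousOnInterval f a b) :
    |f b - f a| ≤ ∫ t in a..b, |deriv f t| := by
  rw [← hf.integral_deriv_eq_sub]
  exact intervalIntegral.abs_integral_le_integral_abs hab

/-- The primitive of `f' log (f + ε)` is `(f + ε) log (f + ε) - f`, so that its integral over a
closed path vanishes. -/
lemma AbsolutelyContinuousOnInterval.integral_deriv_mul_log_eq_zero {f : ℝ → ℝ} {a b ε : ℝ}
    (hf : AbsolutelyContinuousOnInterval f a b) (h0 : ∀ t, 0 ≤ f t) (h1 : ∀ t, f t ≤ 1)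
    (hε : 0 < ε) (hab : f a = f b) :
    IntervalIntegrable (fun t => deriv f t * Real.log (f t + ε)) volume a b ∧
      ∫ t in a..b, deriv f t * Real.log (f t + ε) = 0 := by
  let G : ℝ → ℝ := fun x => (x + ε) * Real.log (x + ε) - x
  have hG : ∀ x, 0 ≤ x → HasDerivAt G (Real.log (x + ε)) x := by
    intro x hx
    have hx' : x + ε ≠ 0 := by positivity
    have h := (((hasDerivAt_id x).add_const ε).mul
      (((hasDerivAt_id x).add_const ε).log hx')).sub (hasDerivAt_id x)
    refine HasDerivAt.congr_deriv h ?_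
    rw [mul_one_div_cancel (show id x + ε ≠ 0 from hx'), one_mul, add_sub_cancel_right, id]
  have hGc : ContDiffOn ℝ 1 G (Set.Icc 0 1) := by
    intro x hx
    have hx' : x + ε ≠ 0 := by have := hx.1; positivity
    have : ContDiffAt ℝ 1 (fun x => Real.log (x + ε)) x :=
      (contDiffAt_id.add contDiffAt_const).log hx'
    exact (((contDiffAt_id.add contDiffAt_const).mul this).sub contDiffAt_id).contDiffWithinAt
  obtain ⟨K, hK⟩ := hGc.exists_lipschitzOnWith (by decide) (convex_Icc _ _) isCompact_Icc
  have hac : AbsolutelyContinuousOnInterval (fun t => G (f t)) a b :=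
    hf.of_dist_le_mul fun x _ y _ => hK.dist_le_mul _ ⟨h0 x, h1 x⟩ _ ⟨h0 y, h1 y⟩
  have hderiv : ∀ᵐ t, t ∈ Set.uIoc a b →
      deriv (fun t => G (f t)) t = deriv f t * Real.log (f t + ε) := by
    filter_upwards [hf.ae_differentiableAt] with t ht hmem
    have := (hG (f t) (h0 t)).comp t (ht (Set.uIoc_subset_uIcc hmem)).hasDerivAt
    rw [mul_comm]
    exact this.deriv
  refine ⟨hac.intervalIntegrable_deriv.congr_ae ?_, ?_⟩
  · rwa [EventuallyEq, ae_restrict_iff' measurableSet_uIoc]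
  · rw [← intervalIntegral.integral_congr_ae hderiv, hac.integral_deriv_eq_sub, hab, sub_self]

/-! ### Length as a limit over uniform partitions -/

/-- For a continuous function of bounded variation, the variation is the limit of the sums over
uniform partitions. Lower semicontinuity applies to the step functions that interpolate the
function on the grids. -/
lemma tendsto_sum_abs_sub_uniform_partition {f : ℝ → ℝ} {τ : ℝ} (hτ : 0 < τ)
    (hf : ContinuousOn f (Set.Icc 0 τ)) (hbv : BoundedVariationOn f (Set.Icc 0 τ)) :
    Tendsto (fun K : ℕ => ∑ k ∈ Finset.range K,
      |f ((k : ℝ) * (τ / K)) - f (((k : ℝ) + 1) * (τ / K))|) atTop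
      (𝓝 (eVariationOn f (Set.Icc 0 τ)).toReal) := by
  let u : ℕ → ℕ → ℝ := fun K k => (k : ℝ) * (τ / K)
  have hu : ∀ K, Monotone (u K) := fun K i j hij => by
    have : (0 : ℝ) ≤ τ / K := by positivity
    exact mul_le_mul_of_nonneg_right (Nat.cast_le.2 hij) this
  have hsub : ∀ K, u K '' Set.Iic K ⊆ Set.Icc 0 τ := by
    rintro K _ ⟨k, hk, rfl⟩
    have hkK : (k : ℝ) ≤ K := Nat.cast_le.2 hk
    refine ⟨by positivity, ?_⟩
    rcases K.eq_zero_or_pos with rfl | hK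
    · simpa [u] using hτ.le
    · have : (0 : ℝ) < K := Nat.cast_pos.2 hK
      calc (k : ℝ) * (τ / K) ≤ K * (τ / K) := by gcongr
        _ = τ := by field_simp
  have hS : ∀ K, eVariationOn f (u K '' Set.Iic K)
      = ∑ k ∈ Finset.range K, edist (f (u K k)) (f (u K (k + 1))) := fun K =>
    eVariationOn.image_range_of_monotone f (hu K) K
  have hlim : Tendsto (fun K => eVariationOn f (u K '' Set.Iic K)) atTop
      (𝓝 (eVariationOn f (Set.Icc 0 τ))) := by
    refine tendsto_order.2 ⟨fun v hv => ?_, fun v hv => Eventually.of_forall fun K =>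
      (eVariationOn.mono f (hsub K)).trans_lt hv⟩
    -- rounding down to the grid
    let φ : ℕ → ℝ → ℝ := fun K x => u K ⌊x / τ * K⌋₊
    have hφ : ∀ K, 0 < K → Set.MapsTo (φ K) (Set.Icc 0 τ) (u K '' Set.Iic K) := by
      intro K hK x hx
      refine ⟨_, ?_, rfl⟩
      refine Nat.floor_le_of_le ?_
      exact mul_le_of_le_one_left (Nat.cast_nonneg K) ((div_le_one hτ).2 hx.2)
    have hmono : ∀ K, MonotoneOn (φ K) (Set.Icc 0 τ) := fun K x _ y _ hxy =>
      hu K (Nat.floor_mono (by gcongr))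
    have hpt : ∀ x ∈ Set.Icc 0 τ, Tendsto (fun K => (f ∘ φ K) x) atTop (𝓝 (f x)) := by
      intro x hx
      refine (hf x hx).tendsto.comp (tendsto_nhdsWithin_iff.2 ⟨?_, ?_⟩)
      · have h1 := ((tendsto_nat_floor_mul_div_atTop (R := ℝ)
          (div_nonneg hx.1 hτ.le)).comp tendsto_natCast_atTop_atTop).mul_const τ
        rw [div_mul_cancel₀ x hτ.ne'] at h1
        refine h1.congr fun K => ?_
        simp only [Function.comp, φ, u]
        ring
      · filter_upwards [eventually_gt_atTop 0] with K hK
        exact hsub K (hφ K hK hx)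
    filter_upwards [eVariationOn.lowerSemicontinuous_aux hpt hv, eventually_gt_atTop 0] with K h hK
    exact h.trans_le (eVariationOn.comp_le_of_monotoneOn f (φ K) (hmono K) (hφ K hK))
  refine ((ENNReal.tendsto_toReal hbv).comp hlim).congr fun K => ?_
  rw [Function.comp, hS, ENNReal.toReal_sum fun _ _ => edist_ne_top _ _]
  refine Finset.sum_congr rfl fun k _ => ?_
  rw [← dist_edist, Real.dist_eq]
  simp only [u]
  push_cast
  rfl

lemma AbsolutelyContinuousOnInterval.sum_abs_sub_uniform_partition_le {f : ℝ → ℝ} {τ : ℝ}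
    (hτ : 0 < τ) (hf : AbsolutelyContinuousOnInterval f 0 τ) (K : ℕ) :
    ∑ k ∈ Finset.range K, |f ((k : ℝ) * (τ / K)) - f (((k : ℝ) + 1) * (τ / K))|
      ≤ ∫ t in (0 : ℝ)..τ, |deriv f t| := by
  rcases K.eq_zero_or_pos with rfl | hK
  · simp only [Finset.range_zero, Finset.sum_empty]
    exact intervalIntegral.integral_nonneg hτ.le fun _ _ => abs_nonneg _
  have hK' : (0 : ℝ) < K := Nat.cast_pos.2 hK
  let u : ℕ → ℝ := fun k => (k : ℝ) * (τ / K)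
  have hu : Monotone u := fun i j hij => by
    have : (0 : ℝ) ≤ τ / K := by positivity
    exact mul_le_mul_of_nonneg_right (Nat.cast_le.2 hij) this
  have hu0 : u 0 = 0 := by simp [u]
  have huK : u K = τ := by simp only [u]; field_simp
  have hsub : ∀ k < K, Set.uIcc (u k) (u (k + 1)) ⊆ Set.uIcc 0 τ := by
    intro k hk
    rw [Set.uIcc_of_le (hu k.le_succ), Set.uIcc_of_le hτ.le]
    exact Set.Icc_subset_Icc (hu0 ▸ hu k.zero_le) (huK ▸ hu hk)
  have hint := intervalIntegral.sum_integral_adjacent_intervals (a := u) (n := K)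
    (f := fun t => |deriv f t|) (μ := volume)
    fun k hk => (hf.mono (hsub k hk)).intervalIntegrable_deriv.abs
  rw [hu0, huK] at hint
  rw [← hint]
  refine Finset.sum_le_sum fun k hk => ?_
  have := (hf.mono (hsub k (Finset.mem_range.1 hk))).abs_sub_le_integral_abs_deriv
    (hu k.le_succ)
  rw [abs_sub_comm] at this
  simpa [u] using this

/-! ### Cyclic heat engines -/

namespace CyclicHeatEngine

section Thermodynamics

variable {n κ : Type*} [Fintype n] [Fintype κ] (E : CyclicHeatEngine n κ)

lemma beta_eq (t : ℝ) : E.β t = 1 / E.Tc - E.carnotEfficiency / E.Tc * E.α t := by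
  have h1 := E.Tc_pos
  have h2 : 0 < E.Th := h1.trans_le E.Tc_le_Th
  have h3 : 0 < E.Th + E.α t * (E.Tc - E.Th) := by
    nlinarith [(E.α_mem t).1, (E.α_mem t).2, E.Tc_le_Th]
  rw [β, bathTemperature, carnotEfficiency]
  field_simp
  ring

lemma abs_beta_le (t : ℝ) : |E.β t| ≤ 1 / E.Tc := by
  have h1 := E.Tc_pos
  have h2 : 0 < E.Th := h1.trans_le E.Tc_le_Th
  have hc0 : 0 ≤ E.carnotEfficiency := sub_nonneg.2 ((div_le_one h2).2 E.Tc_le_Th)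
  have hc1 : E.carnotEfficiency ≤ 1 := sub_le_self _ (by positivity)
  have h : E.β t = (1 - E.carnotEfficiency * E.α t) / E.Tc := by rw [beta_eq]; ring
  have h3 : E.carnotEfficiency * E.α t ≤ 1 := mul_le_one₀ hc1 (E.α_mem t).1 (E.α_mem t).2
  have h4 : 0 ≤ E.carnotEfficiency * E.α t := mul_nonneg hc0 (E.α_mem t).1
  rw [h, abs_of_nonneg (div_nonneg (sub_nonneg.2 h3) h1.le)]
  gcongr
  linarith

lemma ae_matDeriv_eq : ∀ᵐ t, matDeriv E.ρ t
    = lindbladGenerator (E.H t) (fun k => E.L k t) (E.ρ t) := by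
  filter_upwards [E.master_equation] with t ht
  ext i j
  exact (ht i j).deriv

lemma heatRate_intervalIntegrable : IntervalIntegrable E.heatRate volume 0 E.τ := by
  have h : IntervalIntegrable (fun t => (E.H t * matDeriv E.ρ t).trace) volume 0 E.τ := by
    simp only [Matrix.trace, Matrix.diag_apply, Matrix.mul_apply]
    refine IntervalIntegrable.fun_finsetSum _ fun i _ =>
      IntervalIntegrable.fun_finsetSum _ fun j _ => ?_
    exact ((E.ρ_absCont j i).intervalIntegrable_deriv_complex).continuousOn_mul
      (E.H_absCont i j).continuousOn
  exact ⟨h.1.re, h.2.re⟩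

lemma alpha_mul_heatRate_intervalIntegrable :
    IntervalIntegrable (fun t => E.α t * E.heatRate t) volume 0 E.τ := by
  have hb : ∀ t, ‖E.α t‖ ≤ 1 := fun t => by
    rw [Real.norm_of_nonneg (E.α_mem t).1]; exact (E.α_mem t).2
  have h := E.heatRate_intervalIntegrable
  exact ⟨h.1.bdd_mul E.α_measurable.aestronglyMeasurable (Eventually.of_forall hb),
    h.2.bdd_mul E.α_measurable.aestronglyMeasurable (Eventually.of_forall hb)⟩

lemma beta_mul_heatRate_eq : (fun t => E.β t * E.heatRate t)
    = fun t => 1 / E.Tc * E.heatRate t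
      - E.carnotEfficiency / E.Tc * (E.α t * E.heatRate t) := by
  ext t
  rw [beta_eq]
  ring

lemma beta_mul_heatRate_intervalIntegrable :
    IntervalIntegrable (fun t => E.β t * E.heatRate t) volume 0 E.τ := by
  rw [beta_mul_heatRate_eq]
  exact (E.heatRate_intervalIntegrable.const_mul _).sub
    (E.alpha_mul_heatRate_intervalIntegrable.const_mul _)

/-- The energy balance over one period. -/
lemma tau_mul_power : E.τ * E.power = ∫ t in (0 : ℝ)..E.τ, E.heatRate t := by
  let f : ℝ → ℝ := fun t => (E.H t * E.ρ t).trace.re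
  have hf : AbsolutelyContinuousOnInterval f 0 E.τ := by
    refine AbsolutelyContinuousOnInterval.of_dist_le_sum (s := Finset.univ)
      (g := fun (x : n × n) t => E.H t x.1 x.2 * E.ρ t x.2 x.1)
      (fun x _ => (E.H_absCont x.1 x.2).fun_smul (E.ρ_absCont x.2 x.1)) fun x _ y _ => ?_
    have h1 : ∀ t, (E.H t * E.ρ t).trace = ∑ x : n × n, E.H t x.1 x.2 * E.ρ t x.2 x.1 := by
      intro t
      simp only [Matrix.trace, Matrix.diag_apply, Matrix.mul_apply, Fintype.sum_prod_type]
    refine le_trans ?_ (dist_sum_sum_le _ _ _)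
    rw [Real.dist_eq, dist_eq_norm, ← Complex.sub_re, h1, h1]
    exact Complex.abs_re_le_norm _
  have hderiv : ∀ᵐ t, t ∈ Set.uIoc 0 E.τ →
      (matDeriv E.H t * E.ρ t).trace.re = deriv f t - E.heatRate t := by
    have hH : ∀ᵐ t, ∀ i j, t ∈ Set.uIcc 0 E.τ → DifferentiableAt ℝ (fun s => E.H s i j) t :=
      ae_all_iff.2 fun i => ae_all_iff.2 fun j =>
        (E.H_absCont i j).ae_hasDerivAt_complex.mono fun t ht hm => (ht hm).differentiableAt
    filter_upwards [hH, E.master_equation] with t hHt hρt hm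
    have hm' := Set.uIoc_subset_uIcc hm
    have hd : HasDerivAt (fun s => (E.H s * E.ρ s).trace)
        ((matDeriv E.H t * E.ρ t).trace + (E.H t * matDeriv E.ρ t).trace) t := by
      simp only [Matrix.trace, Matrix.diag_apply, Matrix.mul_apply, ← Finset.sum_add_distrib]
      refine HasDerivAt.fun_sum fun i _ => HasDerivAt.fun_sum fun j _ => ?_
      exact (hHt i j hm').hasDerivAt.mul (hρt j i).differentiableAt.hasDerivAt
    have hre : HasDerivAt f
        ((matDeriv E.H t * E.ρ t).trace + (E.H t * matDeriv E.ρ t).trace).re t :=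
      (Complex.reCLM.hasFDerivAt.comp_hasDerivAt t hd)
    rw [hre.deriv, Complex.add_re, heatRate, add_sub_cancel_right]
  have hper : f E.τ = f 0 := by
    have h1 := E.H_periodic 0
    have h2 := E.ρ_periodic 0
    rw [zero_add] at h1 h2
    simp only [f, h1, h2]
  rw [power, intervalIntegral.integral_congr_ae hderiv,
    intervalIntegral.integral_sub hf.intervalIntegrable_deriv E.heatRate_intervalIntegrable,
    hf.integral_deriv_eq_sub, hper, sub_self, zero_sub, mul_neg,
    mul_neg, mul_neg, neg_neg, ← mul_assoc, mul_inv_cancel₀ E.τ_pos.ne', one_mul]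

lemma tau_mul_heatSupply :
    E.τ * E.heatSupply = ∫ t in (0 : ℝ)..E.τ, E.α t * E.heatRate t := by
  rw [heatSupply, ← mul_assoc, mul_inv_cancel₀ E.τ_pos.ne', one_mul]

lemma tau_mul_activity : E.τ * E.activity
    = ∫ t in (0 : ℝ)..E.τ, ∑ k, (E.L k t * E.ρ t * (E.L k t)ᴴ).trace.re := by
  rw [activity, ← mul_assoc, mul_inv_cancel₀ E.τ_pos.ne', one_mul]

lemma activity_intervalIntegrable : IntervalIntegrable
    (fun t => ∑ k, (E.L k t * E.ρ t * (E.L k t)ᴴ).trace.re) volume 0 E.τ := by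
  have h : ∀ k, IntervalIntegrable (fun t => (E.L k t * E.ρ t * (E.L k t)ᴴ).trace)
      volume 0 E.τ := by
    intro k
    simp only [Matrix.trace, Matrix.diag_apply, Matrix.mul_apply, Finset.sum_mul]
    refine IntervalIntegrable.fun_finsetSum _ fun i _ =>
      IntervalIntegrable.fun_finsetSum _ fun j _ =>
      IntervalIntegrable.fun_finsetSum _ fun l _ => ?_
    have hL : IntervalIntegrable (fun t => E.L k t i l * star (E.L k t i j)) volume 0 E.τ := by
      rw [intervalIntegrable_iff_integrableOn_Ioc_of_le E.τ_pos.le]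
      exact (E.L_memLp k i l).integrable_mul (E.L_memLp k i j).star
    refine (hL.mul_continuousOn (E.ρ_absCont l j).continuousOn).congr fun t _ => ?_
    simp only [Matrix.conjTranspose_apply]
    ring
  exact IntervalIntegrable.fun_finsetSum _ fun k _ => ⟨(h k).1.re, (h k).2.re⟩

lemma jumpNorm_intervalIntegrable : IntervalIntegrable
    (fun t => ∑ k, ∑ m, ∑ j, ‖E.L k t m j‖ ^ 2) volume 0 E.τ := by
  refine IntervalIntegrable.fun_finsetSum _ fun k _ =>
    IntervalIntegrable.fun_finsetSum _ fun m _ =>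
    IntervalIntegrable.fun_finsetSum _ fun j _ => ?_
  rw [intervalIntegrable_iff_integrableOn_Ioc_of_le E.τ_pos.le]
  exact (E.L_memLp k m j).integrable_norm_pow (by norm_num)

lemma activity_nonneg : 0 ≤ E.τ * E.activity := by
  rw [tau_mul_activity]
  refine intervalIntegral.integral_nonneg E.τ_pos.le fun t _ => Finset.sum_nonneg fun k _ => ?_
  exact (Complex.nonneg_iff.1
    ((E.ρ_posSemidef t).mul_mul_conjTranspose_same (E.L k t)).trace_nonneg).1

/-- The affinities `β ω` of all nonvanishing jumps are uniformly bounded over a period, because the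
Hamiltonian is continuous. -/
lemma exists_energyChange_bound : ∃ X, ∀ t ∈ Set.Icc 0 E.τ,
    |E.β t| * (2 * ∑ i, ∑ j, ‖E.H t i j‖) ≤ X := by
  have hc : ContinuousOn (fun t => ∑ i, ∑ j, ‖E.H t i j‖) (Set.Icc 0 E.τ) := by
    refine continuousOn_finsetSum _ fun i _ => continuousOn_finsetSum _ fun j _ => ?_
    rw [← Set.uIcc_of_le E.τ_pos.le]
    exact (E.H_absCont i j).continuousOn.norm
  obtain ⟨C, hC⟩ := isCompact_Icc.exists_bound_of_continuousOn hc
  have hTc := E.Tc_pos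
  refine ⟨1 / E.Tc * (2 * |C|), fun t ht => ?_⟩
  have h1 : ∑ i, ∑ j, ‖E.H t i j‖ ≤ |C| :=
    ((le_abs_self _).trans (hC t ht)).trans (le_abs_self C)
  exact mul_le_mul (E.abs_beta_le t) (by linarith) (by positivity) (by positivity)

end Thermodynamics

variable {n κ : Type*} [Fintype n] [DecidableEq n] [Fintype κ] (E : CyclicHeatEngine n κ)

/-- The eigenvalues of the state `ρ_t`, in decreasing order along an enumeration of `n` that does
not depend on `t`. -/
noncomputable def population (t : ℝ) (i : n) : ℝ := (E.ρ_posSemidef t).isHermitian.eigenvalues i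

lemma population_nonneg (t : ℝ) (i : n) : 0 ≤ E.population t i :=
  (E.ρ_posSemidef t).eigenvalues_nonneg i

lemma population_le_one (t : ℝ) (i : n) : E.population t i ≤ 1 := by
  have h := (E.ρ_posSemidef t).isHermitian.trace_eq_sum_eigenvalues
  rw [E.ρ_trace t] at h
  have h' : ∑ j, E.population t j = 1 := by
    rw [← Complex.ofReal_inj, Complex.ofReal_sum, Complex.ofReal_one]
    exact h.symm
  rw [← h']
  exact Finset.single_le_sum (fun j _ => E.population_nonneg t j) (Finset.mem_univ i)

lemma population_tau (i : n) : E.population 0 i = E.population E.τ i := by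
  have h := E.ρ_periodic 0
  rw [zero_add] at h
  simp only [population, h]

lemma population_absCont (i : n) :
    AbsolutelyContinuousOnInterval (fun t => E.population t i) 0 E.τ := by
  refine AbsolutelyContinuousOnInterval.of_dist_le_sum (s := Finset.univ)
    (g := fun (x : n × n) t => E.ρ t x.1 x.2) (fun x _ => E.ρ_absCont x.1 x.2) fun x _ y _ => ?_
  simp only [Fintype.sum_prod_type, dist_eq_norm]
  exact (E.ρ_posSemidef x).isHermitian.abs_eigenvalues_sub_le (E.ρ_posSemidef y).isHermitian i

lemma entropyProduction_eq : E.entropyProduction = -∫ t in (0 : ℝ)..E.τ, E.β t * E.heatRate t := by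
  have h : vonNeumannEntropy (E.ρ_posSemidef E.τ).isHermitian
      = vonNeumannEntropy (E.ρ_posSemidef 0).isHermitian := by
    have h := E.ρ_periodic 0
    rw [zero_add] at h
    simp only [vonNeumannEntropy, h]
  rw [entropyProduction, h, sub_self, zero_sub]

/-- The first law combined with the decomposition of the inverse temperature. -/
lemma entropyProduction_eq_power_heatSupply :
    E.Tc * E.entropyProduction = E.τ * (E.carnotEfficiency * E.heatSupply - E.power) := by
  have hTc := E.Tc_pos.ne'
  rw [entropyProduction_eq, beta_mul_heatRate_eq, intervalIntegral.integral_sub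
    (E.heatRate_intervalIntegrable.const_mul _)
    (E.alpha_mul_heatRate_intervalIntegrable.const_mul _), intervalIntegral.integral_const_mul,
    intervalIntegral.integral_const_mul, ← tau_mul_power, ← tau_mul_heatSupply]
  field_simp
  ring

/-- The entropy production rate, with regularized surprisals, at almost every time. -/
lemma ae_entropyProduction_ge {ε X z : ℝ} (hε : 0 < ε) (hε1 : ε ≤ 1)
    (hX : ∀ t ∈ Set.Icc 0 E.τ, |E.β t| * (2 * ∑ i, ∑ j, ‖E.H t i j‖) ≤ X) (hz : 0 ≤ z) :
    ∀ᵐ t, t ∈ Set.Icc 0 E.τ →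
      (z + Real.sinh z * Real.cosh z) * ∑ i, |deriv (fun s => E.population s i) t|
        - 2 * Real.sinh z ^ 2 * ∑ k, (E.L k t * E.ρ t * (E.L k t)ᴴ).trace.re
        - ε * (2 * (z + Real.sinh z * Real.cosh z + Real.sinh z ^ 2) + (X + Real.log (2 / ε)))
          * ∑ k, ∑ m, ∑ j, ‖E.L k t m j‖ ^ 2
        ≤ -(E.β t * E.heatRate t)
          - ∑ i, deriv (fun s => E.population s i) t * Real.log (E.population t i + ε) := by
  have hp : ∀ᵐ t, ∀ i, t ∈ Set.uIcc 0 E.τ → DifferentiableAt ℝ (fun s => E.population s i) t :=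
    ae_all_iff.2 fun i => (E.population_absCont i).ae_differentiableAt
  filter_upwards [hp, E.master_equation, E.ae_matDeriv_eq] with t hpt hρt hmat ht
  rw [← Set.uIcc_of_le E.τ_pos.le] at ht
  obtain ⟨U, hU, hdiag, hdU⟩ := exists_unitary_diag_deriv_eq
    (fun s => (E.ρ_posSemidef s).isHermitian) hρt fun i => (hpt i ht).hasDerivAt
  rw [Set.uIcc_of_le E.τ_pos.le] at ht
  rw [heatRate, hmat]
  exact lindblad_entropyProduction_ge (E.H_hermitian t) E.pair_pair (fun k => E.ω_pair k t)
    (fun k => E.energy_change k t) (fun k => E.detailed_balance k t) hU hdiag hdU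
    (E.population_nonneg t) (E.population_le_one t) hε hε1 (hX t ht) hz

/-- The integrated bound: the regularized surprisal terms form an exact derivative, which integrates
to zero over a period. -/
lemma entropyProduction_ge_regularized {ε X z : ℝ} (hε : 0 < ε) (hε1 : ε ≤ 1)
    (hX : ∀ t ∈ Set.Icc 0 E.τ, |E.β t| * (2 * ∑ i, ∑ j, ‖E.H t i j‖) ≤ X) (hz : 0 ≤ z) :
    (z + Real.sinh z * Real.cosh z) *
        ∑ i, (∫ t in (0 : ℝ)..E.τ, |deriv (fun s => E.population s i) t|)
      - 2 * Real.sinh z ^ 2 * (E.τ * E.activity)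
      - ε * (2 * (z + Real.sinh z * Real.cosh z + Real.sinh z ^ 2) + (X + Real.log (2 / ε)))
        * (∫ t in (0 : ℝ)..E.τ, ∑ k, ∑ m, ∑ j, ‖E.L k t m j‖ ^ 2)
      ≤ E.entropyProduction := by
  have hd : ∀ i, IntervalIntegrable (fun t => |deriv (fun s => E.population s i) t|)
      volume 0 E.τ := fun i => (E.population_absCont i).intervalIntegrable_deriv.abs
  have hds : IntervalIntegrable (fun t => ∑ i, |deriv (fun s => E.population s i) t|)
      volume 0 E.τ :=
    IntervalIntegrable.fun_finsetSum _ fun i _ => hd i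
  have hl := fun i => (E.population_absCont i).integral_deriv_mul_log_eq_zero
    (fun t => E.population_nonneg t i) (fun t => E.population_le_one t i) hε (E.population_tau i)
  have hls : IntervalIntegrable (fun t => ∑ i, deriv (fun s => E.population s i) t
      * Real.log (E.population t i + ε)) volume 0 E.τ :=
    IntervalIntegrable.fun_finsetSum _ fun i _ => (hl i).1
  have hmono := intervalIntegral.integral_mono_ae_restrict E.τ_pos.le
    (((hds.const_mul _).sub (E.activity_intervalIntegrable.const_mul _)).sub
      (E.jumpNorm_intervalIntegrable.const_mul _))
    (E.beta_mul_heatRate_intervalIntegrable.neg.sub hls)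
    ((ae_restrict_iff' measurableSet_Icc).2 (E.ae_entropyProduction_ge hε hε1 hX hz))
  rw [intervalIntegral.integral_sub
      ((hds.const_mul _).sub (E.activity_intervalIntegrable.const_mul _))
      (E.jumpNorm_intervalIntegrable.const_mul _),
    intervalIntegral.integral_sub (hds.const_mul _) (E.activity_intervalIntegrable.const_mul _),
    intervalIntegral.integral_sub E.beta_mul_heatRate_intervalIntegrable.neg hls] at hmono
  simp only [intervalIntegral.integral_const_mul, Pi.neg_apply, intervalIntegral.integral_neg]
    at hmono
  rw [intervalIntegral.integral_finsetSum fun i _ => hd i,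
    intervalIntegral.integral_finsetSum fun i _ => (hl i).1,
    Finset.sum_eq_zero fun i _ => (hl i).2, sub_zero, ← tau_mul_activity,
    ← entropyProduction_eq] at hmono
  exact hmono

/-- In the limit `ε → 0`, the tangent planes of `2 J artanh (J / A)` bound the entropy production
from below; here `2 J` is the integrated speed of the populations. -/
lemma entropyProduction_ge_tangent {z : ℝ} (hz : 0 ≤ z) :
    (z + Real.sinh z * Real.cosh z) *
        ∑ i, (∫ t in (0 : ℝ)..E.τ, |deriv (fun s => E.population s i) t|)
      - 2 * Real.sinh z ^ 2 * (E.τ * E.activity) ≤ E.entropyProduction := by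
  obtain ⟨X, hX⟩ := E.exists_energyChange_bound
  set B := 2 * (z + Real.sinh z * Real.cosh z + Real.sinh z ^ 2)
  set N := ∫ t in (0 : ℝ)..E.τ, ∑ k, ∑ m, ∑ j, ‖E.L k t m j‖ ^ 2
  -- the error of the regularization is of order `ε log (1 / ε)`
  have hlim : Tendsto (fun ε : ℝ => ε * (B + (X + Real.log (2 / ε))) * N) (𝓝[>] 0) (𝓝 0) := by
    have h1 : Tendsto (fun ε : ℝ => (ε * (B + X + Real.log 2) - ε * Real.log ε) * N) (𝓝 0)
        (𝓝 ((0 * (B + X + Real.log 2) - 0 * Real.log 0) * N)) :=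
      (((continuous_id.mul continuous_const).sub Real.continuous_mul_log).mul
        continuous_const).tendsto 0
    simp only [zero_mul, sub_zero] at h1
    refine (h1.mono_left nhdsWithin_le_nhds).congr' ?_
    filter_upwards [self_mem_nhdsWithin] with ε hε
    rw [Real.log_div (by norm_num) (ne_of_gt hε)]
    ring
  have hlim' := hlim.const_sub ((z + Real.sinh z * Real.cosh z) *
        ∑ i, (∫ t in (0 : ℝ)..E.τ, |deriv (fun s => E.population s i) t|)
      - 2 * Real.sinh z ^ 2 * (E.τ * E.activity))
  rw [sub_zero] at hlim'
  refine le_of_tendsto hlim' ?_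
  filter_upwards [Ioc_mem_nhdsGT (zero_lt_one' ℝ)] with ε hε
  exact E.entropyProduction_ge_regularized hε.1 hε.2 hX hz

/-- The Wasserstein length exists, and it is at most the integrated speed of the populations. -/
lemma exists_isWassersteinLength : ∃ ℓ, E.IsWassersteinLength ℓ ∧ 0 ≤ ℓ ∧
    2 * ℓ ≤ ∑ i, (∫ t in (0 : ℝ)..E.τ, |deriv (fun s => E.population s i) t|) := by
  have hW : ∀ s t, quantumWasserstein (E.ρ_posSemidef s).isHermitian (E.ρ_posSemidef t).isHermitian
      = (∑ i, |E.population s i - E.population t i|) / 2 := by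
    intro s t
    rw [quantumWasserstein]
    congr 1
    exact (Equiv.sum_comp (Fintype.equivOfCardEq (Fintype.card_fin (Fintype.card n))).symm
      fun i => |(E.ρ_posSemidef s).isHermitian.eigenvalues₀ i
        - (E.ρ_posSemidef t).isHermitian.eigenvalues₀ i|).symm
  have hsum : (fun K : ℕ => ∑ k ∈ Finset.range K,
      quantumWasserstein (E.ρ_posSemidef ((k : ℝ) * (E.τ / K))).isHermitian
        (E.ρ_posSemidef (((k : ℝ) + 1) * (E.τ / K))).isHermitian)
      = fun K : ℕ => (∑ i, ∑ k ∈ Finset.range K, |E.population ((k : ℝ) * (E.τ / K)) i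
          - E.population (((k : ℝ) + 1) * (E.τ / K)) i|) / 2 := by
    ext K
    simp only [hW]
    rw [← Finset.sum_div, Finset.sum_comm]
  have hτ := E.τ_pos
  have hlim : ∀ i, Tendsto (fun K : ℕ => ∑ k ∈ Finset.range K,
      |E.population ((k : ℝ) * (E.τ / K)) i - E.population (((k : ℝ) + 1) * (E.τ / K)) i|) atTop
      (𝓝 (eVariationOn (fun t => E.population t i) (Set.Icc 0 E.τ)).toReal) := by
    intro i
    have h := E.population_absCont i
    have hc := h.continuousOn
    have hbv := h.boundedVariationOn
    rw [Set.uIcc_of_le hτ.le] at hc hbv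
    exact tendsto_sum_abs_sub_uniform_partition (f := fun t => E.population t i) hτ hc hbv
  refine ⟨(∑ i, (eVariationOn (fun t => E.population t i) (Set.Icc 0 E.τ)).toReal) / 2, ?_, ?_, ?_⟩
  · rw [IsWassersteinLength, hsum]
    exact (tendsto_finsetSum _ fun i _ => hlim i).div_const 2
  · exact div_nonneg (Finset.sum_nonneg fun _ _ => ENNReal.toReal_nonneg) zero_le_two
  · rw [mul_div_cancel₀ _ two_ne_zero]
    exact Finset.sum_le_sum fun i _ => le_of_tendsto' (hlim i) fun K =>
      (E.population_absCont i).sum_abs_sub_uniform_partition_le hτ K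

end CyclicHeatEngine

theorem mainTheorem1 {n κ : Type*} [Fintype n] [DecidableEq n] [Fintype κ]
    (E : CyclicHeatEngine n κ) :
    ∃ ℓ : ℝ, E.IsWassersteinLength ℓ ∧
      (ℓ < E.τ * E.activity ∨ (ℓ = 0 ∧ E.activity = 0)) ∧
      2 * ℓ * Real.artanh (ℓ / (E.τ * E.activity)) ≤ E.entropyProduction ∧
      (E.power ≠ 0 → E.heatSupply ≠ 0 →
        2 * E.Tc * (ℓ / E.τ) * Real.artanh (ℓ / (E.τ * E.activity)) ≤
          E.power * (E.carnotEfficiency / E.efficiency - 1)) := by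
  obtain ⟨ℓ, hℓ, hℓ0, hℓle⟩ := E.exists_isWassersteinLength
  have hτ := E.τ_pos
  have hTc := E.Tc_pos
  obtain ⟨hlt, hS⟩ := two_mul_artanh_le_of_tangent (S := E.entropyProduction) hℓ0 E.activity_nonneg
    fun z hz => by
      have hc : 0 ≤ z + Real.sinh z * Real.cosh z := by
        have := Real.sinh_nonneg_iff.2 hz
        have := Real.cosh_pos z
        positivity
      have h1 := mul_le_mul_of_nonneg_left hℓle hc
      have h2 := E.entropyProduction_ge_tangent hz
      linarith
  refine ⟨ℓ, hℓ, hlt.imp_right fun h => ⟨h.1, (mul_eq_zero.1 h.2).resolve_left hτ.ne'⟩, hS,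
    fun hP hJ => ?_⟩
  have hbal : E.power * (E.carnotEfficiency / E.efficiency - 1)
      = E.Tc * E.entropyProduction / E.τ := by
    rw [E.entropyProduction_eq_power_heatSupply, CyclicHeatEngine.efficiency]
    field_simp
  rw [hbal, le_div_iff₀ hτ]
  calc 2 * E.Tc * (ℓ / E.τ) * Real.artanh (ℓ / (E.τ * E.activity)) * E.τ
      = E.Tc * (2 * ℓ * Real.artanh (ℓ / (E.τ * E.activity))) := by field_simp
    _ ≤ E.Tc * E.entropyProduction := by gcongr
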